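/- Let $q$ be a power of $2$. Represent a point $P=(y_0,\dots,y_5)$ of $\mathrm{PG}(5,q)$ by the symmetric matrix $$M_P=\begin{bmatrix} y_0&y_1&y_2\\ y_1&y_3&y_4\\ y_2&y_4&y_5\end{bmatrix},$$ and let the rank of $P$ be the rank of $M_P$. Let $\mathcal V(\mathbb F_q)=\{(u_0^2,u_0u_1,u_0u_2,u_1^2,u_1u_2,u_2^2): (u_0,u_1,u_2)\in\mathrm{PG}(2,q)\}$ be the Veronese surface, let $\pi_{\mathcal N}=\mathcal Z(Y_0,Y_3,Y_5)$ be the nucleus plane, and let $K\le \mathrm{PGL}(6,q)$ be the group of projectivities induced by $M_P\mapsto AM_PA^{T}$, $A\in\mathrm{GL}(3,q)$. Let $o_{12,1}$ be the $K$-orbit of the line formed by the points with matrix $\begin{bmatrix}0&x&0\\x&0&y\\0&y&0\end{bmatrix}$. The point-orbit distribution of a subspace $W$ is $OD_0(W)=[r_1,r_{2,n},r_{2,s},r_3]$, where $r_1$ and $r_3$ count the points of $W$ of rank $1$ and $3$, and $r_{2,n}$ and $r_{2,s}$ count the points of $W$ of rank $2$ inside and outside $\pi_{\mathcal N}$, respectively.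 **Theorem.** Let $\pi$ be a plane in $\mathrm{PG}(5,q)$ such that $\pi\cap\mathcal V(\mathbb F_q)=\emptyset$ and $\pi\cap\pi_{\mathcal N}\neq\emptyset$. Then one of the following cases holds. (i) $\pi=\pi_{\mathcal N}$; this plane is disjoint from $\mathcal V(\mathbb F_q)$ and $OD_0(\pi_{\mathcal N})=[0,q^2+q+1,0,0]$. (ii) $\pi\cap\pi_{\mathcal N}$ is a line belonging to $o_{12,1}$. In this case $\pi$ has either $0$ or $q$ rank-$2$ points outside $\pi_{\mathcal N}$. The planes of this kind form exactly two $K$-orbits, one with $OD_0(\pi)=[0,q+1,0,q^2]$ and one with $OD_0(\pi)=[0,q+1,q,q^2-q]$. (iii) $\pi\cap\pi_{\mathcal N}$ is a point. In this case $\pi$ has either $0$, $q$, $2q$ or $3q$ rank-$2$ points outside $\pi_{\mathcal N}$. The planes of this kind form exactly six $K$-orbits: (a) one with $OD_0(\pi)=[0,1,0,q^2+q]$, (b) one with $OD_0(\pi)=[0,1,3q,q^2-2q]$, (c) two with $OD_0(\pi)=[0,1,q,q^2]$, and (d) two with $OD_0(\pi)=[0,1,2q,q^2-q]$. -/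

import Mathlib

open scoped LinearAlgebra.Projectivization MatrixGroups Pointwise

namespace VeroneseSurface

variable {F : Type*} [Field F]

/-- The projective plane `PG(2,F)`. -/
abbrev PG2 (F : Type*) [Field F] := ℙ F (Fin 3 → F)

/-- The projective space `PG(5,F)`, with coordinates `(Y₀,…,Y₅)`. -/
abbrev PG5 (F : Type*) [Field F] := ℙ F (Fin 6 → F)

/-- The symmetric `3 × 3` matrix `M_P` attached to a coordinate vector of a point `P`. -/
def symMatrix (y : Fin 6 → F) : Matrix (Fin 3) (Fin 3) F :=
  !![y 0, y 1, y 2;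
     y 1, y 3, y 4;
     y 2, y 4, y 5]

/-- The coordinate vector read off from the upper triangle of a `3 × 3` matrix. -/
def symCoords (M : Matrix (Fin 3) (Fin 3) F) : Fin 6 → F :=
  ![M 0 0, M 0 1, M 0 2, M 1 1, M 1 2, M 2 2]

theorem symCoords_symMatrix (y : Fin 6 → F) : symCoords (symMatrix y) = y := by
  ext i
  fin_cases i <;> rfl

theorem symMatrix_symCoords {M : Matrix (Fin 3) (Fin 3) F} (hM : M.transpose = M) :
    symMatrix (symCoords M) = M := by
  have h : ∀ i j, M i j = M j i := fun i j => congrFun (congrFun hM j) i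
  ext i j
  fin_cases i <;> fin_cases j <;> simp [symMatrix, symCoords, h 1 0, h 2 0, h 2 1]

theorem symMatrix_transpose (y : Fin 6 → F) : (symMatrix y).transpose = symMatrix y := by
  ext i j
  fin_cases i <;> fin_cases j <;> simp [symMatrix]

/-- The linear map on coordinate vectors given by `M ↦ A M Aᵀ` on symmetric matrices. -/
def symLift (A : Matrix (Fin 3) (Fin 3) F) : (Fin 6 → F) →ₗ[F] (Fin 6 → F) where
  toFun y := symCoords (A * symMatrix y * A.transpose)
  map_add' y z := by
    have h : symMatrix (y + z) = symMatrix y + symMatrix z := by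
      ext i j
      fin_cases i <;> fin_cases j <;> simp [symMatrix]
    rw [h, Matrix.mul_add, Matrix.add_mul]
    ext i
    fin_cases i <;> simp [symCoords]
  map_smul' c y := by
    have h : symMatrix (c • y) = c • symMatrix y := by
      ext i j
      fin_cases i <;> fin_cases j <;> simp [symMatrix]
    rw [h, Matrix.mul_smul, Matrix.smul_mul]
    ext i
    fin_cases i <;> simp [symCoords]

theorem symMatrix_symLift (A : Matrix (Fin 3) (Fin 3) F) (y : Fin 6 → F) :
    symMatrix (symLift A y) = A * symMatrix y * A.transpose := by
  refine symMatrix_symCoords ?_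
  rw [Matrix.transpose_mul, Matrix.transpose_mul, Matrix.transpose_transpose,
    symMatrix_transpose, Matrix.mul_assoc]

theorem symLift_one : symLift (1 : Matrix (Fin 3) (Fin 3) F) = LinearMap.id := by
  refine LinearMap.ext fun y => ?_
  simp [symLift, symCoords_symMatrix]

theorem symLift_mul (A B : Matrix (Fin 3) (Fin 3) F) :
    symLift (A * B) = symLift A ∘ₗ symLift B := by
  refine LinearMap.ext fun y => ?_
  change symCoords _ = symCoords (A * symMatrix (symLift B y) * A.transpose)
  rw [symMatrix_symLift, Matrix.transpose_mul]
  simp only [Matrix.mul_assoc]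

/-- The lift `GL(3,F) → GL(6,F)` of the action `M ↦ A M Aᵀ`. -/
def liftGL : GL (Fin 3) F →* GL (Fin 6) F :=
  Units.map
    { toFun := fun A : Matrix (Fin 3) (Fin 3) F => LinearMap.toMatrix' (symLift A)
      map_one' := by rw [symLift_one, LinearMap.toMatrix'_id]
      map_mul' := fun A B => by rw [symLift_mul, LinearMap.toMatrix'_comp] }

theorem liftGL_scalar (u : Fˣ) :
    liftGL (Matrix.GeneralLinearGroup.scalar (Fin 3) u) =
      Matrix.GeneralLinearGroup.scalar (Fin 6) (u * u) := by
  have h : symLift (Matrix.scalar (Fin 3) (u : F)) =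
      ((u : F) * (u : F)) • (LinearMap.id : (Fin 6 → F) →ₗ[F] (Fin 6 → F)) := by
    refine LinearMap.ext fun y => ?_
    ext i
    fin_cases i <;> simp [symLift, symCoords, symMatrix] <;> ring
  refine Units.ext ?_
  change LinearMap.toMatrix' (symLift (Matrix.scalar (Fin 3) (u : F))) =
    Matrix.scalar (Fin 6) ((u : F) * (u : F))
  rw [h, map_smul, LinearMap.toMatrix'_id]
  ext i j
  simp [Matrix.one_apply, Matrix.diagonal_apply]

/-- The homomorphism `α : PGL(3,F) → PGL(6,F)`; the image of the class of `A` sends the point with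
matrix `M` to the point with matrix `A M Aᵀ`. -/
def alpha : PGL(3, F) →* PGL(6, F) :=
  Matrix.ProjGenLinGroup.lift (Matrix.ProjGenLinGroup.mk.comp liftGL) <| by
    refine MonoidHom.ext fun u => ?_
    change Matrix.ProjGenLinGroup.mk (liftGL (Matrix.GeneralLinearGroup.scalar (Fin 3) u)) = 1
    rw [liftGL_scalar, Matrix.ProjGenLinGroup.mk_scalar]

/-- The group `K = α(PGL(3,F)) ≤ PGL(6,F)`. It acts on points of `PG(5,F)`, hence on sets of
points. -/
def K (F : Type*) [Field F] : Subgroup PGL(6, F) := (alpha (F := F)).range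

/-- `S` is the point set of a `d`-dimensional projective subspace of `PG(5,F)`. -/
def IsSubspaceOfDim (d : ℕ) (S : Set (PG5 F)) : Prop :=
  ∃ W : Submodule F (Fin 6 → F), Module.finrank F W = d + 1 ∧ S = {P | P.submodule ≤ W}

/-- `S` is the point set of a plane of `PG(5,F)`. -/
def IsPlane (S : Set (PG5 F)) : Prop := IsSubspaceOfDim 2 S

/-- `(u₀,u₁,u₂) ↦ (u₀², u₀u₁, u₀u₂, u₁², u₁u₂, u₂²)`. -/
def veroneseVec (u : Fin 3 → F) : Fin 6 → F :=
  ![u 0 ^ 2, u 0 * u 1, u 0 * u 2, u 1 ^ 2, u 1 * u 2, u 2 ^ 2]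

theorem veroneseVec_ne_zero {u : Fin 3 → F} (hu : u ≠ 0) : veroneseVec u ≠ 0 := by
  intro h
  apply hu
  have h0 : u 0 ^ 2 = 0 := congrFun h 0
  have h1 : u 1 ^ 2 = 0 := congrFun h 3
  have h2 : u 2 ^ 2 = 0 := congrFun h 5
  ext i
  fin_cases i
  · exact pow_eq_zero_iff two_ne_zero |>.1 h0
  · exact pow_eq_zero_iff two_ne_zero |>.1 h1
  · exact pow_eq_zero_iff two_ne_zero |>.1 h2

/-- The Veronese embedding `PG(2,F) → PG(5,F)`. -/
noncomputable def veronese (u : PG2 F) : PG5 F :=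
  Projectivization.mk F (veroneseVec u.rep) (veroneseVec_ne_zero u.rep_nonzero)

/-- The Veronese surface. -/
def surface (F : Type*) [Field F] : Set (PG5 F) := Set.range (veronese (F := F))

/-- The nucleus plane `Z(Y₀,Y₃,Y₅)` (the fields of interest have characteristic two). -/
def nucleusPlane (F : Type*) [Field F] : Set (PG5 F) :=
  {P | P.rep 0 = 0 ∧ P.rep 3 = 0 ∧ P.rep 5 = 0}

/-- The rank of a point is the rank of its symmetric matrix. -/
noncomputable def pointRank (P : PG5 F) : ℕ := (symMatrix P.rep).rank

/-- The number of points of rank one in `S`. -/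
noncomputable def r1 (S : Set (PG5 F)) : ℕ := {P ∈ S | pointRank P = 1}.ncard

/-- The number of points of rank two in `S` that lie in the nucleus plane. -/
noncomputable def r2n (S : Set (PG5 F)) : ℕ := {P ∈ S ∩ nucleusPlane F | pointRank P = 2}.ncard

/-- The number of points of rank two in `S` that lie outside the nucleus plane. -/
noncomputable def r2s (S : Set (PG5 F)) : ℕ := {P ∈ S \ nucleusPlane F | pointRank P = 2}.ncard

/-- The number of points of rank three in `S`. -/
noncomputable def r3 (S : Set (PG5 F)) : ℕ := {P ∈ S | pointRank P = 3}.ncard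

/-- The point-orbit distribution `[r₁, r₂ₙ, r₂ₛ, r₃]`. -/
noncomputable def OD0 (S : Set (PG5 F)) : Fin 4 → ℕ := ![r1 S, r2n S, r2s S, r3 S]

/-- The line of all points with matrix `[[0,x,0],[x,0,y],[0,y,0]]`. -/
def line12_1 (F : Type*) [Field F] : Set (PG5 F) :=
  {P | ∃ x y : F, symMatrix P.rep = !![0, x, 0; x, 0, y; 0, y, 0]}

/-- The `K`-orbit `o_{12,1}` of lines. -/
def o12_1 (F : Type*) [Field F] : Set (Set (PG5 F)) := MulAction.orbit (K F) (line12_1 F)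

/-- The set of `K`-orbits of planes that are disjoint from the Veronese surface and have the
property `c`. -/
def disjointPlaneOrbits (c : Set (PG5 F) → Prop) : Set (Set (Set (PG5 F))) :=
  {O | ∃ π : Set (PG5 F), IsPlane π ∧ π ∩ surface F = ∅ ∧ c π ∧ O = MulAction.orbit (K F) π}

/-- `π` meets the nucleus plane in a line belonging to `o_{12,1}`. -/
def MeetsNucleusInLine (π : Set (PG5 F)) : Prop := π ∩ nucleusPlane F ∈ o12_1 F

/-- `π` meets the nucleus plane in exactly one point. -/
def MeetsNucleusInPoint (π : Set (PG5 F)) : Prop := ∃ P : PG5 F, π ∩ nucleusPlane F = {P}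

end VeroneseSurface

/-! A plane is a three-dimensional space W of symmetric 3×3 matrices, and its K-orbit is the class
of W under congruence M ↦ AMAᵀ. In characteristic two congruence preserves the space of matrices
with zero diagonal, whose points form the nucleus plane. So the dimension of `W ⊓ zeroDiag F` is an
invariant, and its nonzero values 3, 2, 1 give the three cases. A plane disjoint from the surface
has no points of rank one, because every field element is a square; its distribution is therefore
determined by counting zeros of the determinant outside the nucleus plane.

Dimension 2. Zero-diagonal matrices are bivectors of a three-dimensional space, so GL(3) is
transitive on their two-dimensional subspaces (`isCongruent_baseLine`). Then W is `baseLine F`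
together with one more matrix, disjointness reads c² ≠ ae, and two normal forms remain
(`line_classification`), told apart by their counts 0 and q.

Dimension 1. The diagonals of W satisfy one linear relation; after taking square roots of its
coefficients it says kᵀMk = 0 on W for some k ≠ 0. Moving k to the last basis vector e₂ gives y₅ = 0
(basis vectors are numbered e₀, e₁, e₂). The matrix N spanning `W ⊓ zeroDiag F` may or may not kill
e₂. If it does, the determinant on W is, up to Frobenius, a binary cubic form with coefficients γ,
α, δ, β. Its discriminant is (αδ + βγ)², so disjointness means separability. The form then has no
root, one root or three roots over F, and each type is a single class: forms without roots are all
equivalent because their roots generate the same cubic extension, and the one-root type is unique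
because t ↦ t² + t has image of index two (`cubicFamily_classification`). If it does not, upper
triangular congruences leave three normal forms (`conicFamily_classification`). The counts 0, 3q, q,
q, 2q, 2q leave two pairs unresolved; `HasIsotropicNucleus` and `HasCollinearImages` separate them.
-/

namespace VeroneseSurface

/-! ### From K-orbits of planes to congruence classes of subspaces. -/

section Action

variable {F : Type*} [Field F]

/-- The point set of the projective subspace attached to a subspace of `F⁶`. -/
def points (W : Submodule F (Fin 6 → F)) : Set (PG5 F) := {P | P.submodule ≤ W}

theorem mk_mem_points {W : Submodule F (Fin 6 → F)} {v : Fin 6 → F} (hv : v ≠ 0) :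
    Projectivization.mk F v hv ∈ points W ↔ v ∈ W := by
  simp [points, Projectivization.submodule_mk]

theorem mem_points {W : Submodule F (Fin 6 → F)} {P : PG5 F} : P ∈ points W ↔ P.rep ∈ W := by
  conv_lhs => rw [← P.mk_rep]
  exact mk_mem_points P.rep_nonzero

theorem points_inf (W W' : Submodule F (Fin 6 → F)) :
    points (W ⊓ W') = points W ∩ points W' := by
  ext P
  simp [mem_points]

theorem points_injective : Function.Injective (points (F := F)) := by
  intro W W' h
  ext v
  by_cases hv : v = 0
  · simp [hv]
  · rw [← mk_mem_points hv, h, mk_mem_points hv]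

theorem liftGL_smul (A : GL (Fin 3) F) (v : Fin 6 → F) :
    liftGL A • v = symLift (A : Matrix (Fin 3) (Fin 3) F) v := by
  change (LinearMap.toMatrix' (symLift (A : Matrix (Fin 3) (Fin 3) F))).mulVec v = _
  exact LinearMap.toMatrix'_mulVec _ _

theorem alpha_smul_mk (A : GL (Fin 3) F) {v : Fin 6 → F} (hv : v ≠ 0)
    (hv' : symLift (A : Matrix (Fin 3) (Fin 3) F) v ≠ 0) :
    alpha (Matrix.ProjGenLinGroup.mk A) • Projectivization.mk F v hv =
      Projectivization.mk F (symLift (A : Matrix (Fin 3) (Fin 3) F) v) hv' := by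
  have h : alpha (Matrix.ProjGenLinGroup.mk A) = Matrix.ProjGenLinGroup.mk (liftGL A) := rfl
  rw [h, Projectivization.PGL.mk_smul_mk]
  congr 1
  exact liftGL_smul A v

theorem symLift_inv_apply (A : GL (Fin 3) F) (v : Fin 6 → F) :
    symLift (A⁻¹ : GL (Fin 3) F).1 (symLift A.1 v) = v := by
  rw [← LinearMap.comp_apply, ← symLift_mul, ← Units.val_mul, inv_mul_cancel, Units.val_one,
    symLift_one, LinearMap.id_apply]

theorem symLift_apply_inv (A : GL (Fin 3) F) (v : Fin 6 → F) :
    symLift A.1 (symLift (A⁻¹ : GL (Fin 3) F).1 v) = v := by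
  simpa using symLift_inv_apply A⁻¹ v

theorem symLift_injective (A : GL (Fin 3) F) : Function.Injective (symLift A.1) :=
  Function.LeftInverse.injective (symLift_inv_apply A)

theorem alpha_smul_points (A : GL (Fin 3) F) (W : Submodule F (Fin 6 → F)) :
    alpha (Matrix.ProjGenLinGroup.mk A) • points W = points (W.map (symLift A.1)) := by
  ext P
  rw [Set.mem_smul_set_iff_inv_smul_mem, ← map_inv, ← map_inv]
  induction P using Projectivization.ind with
  | h v hv =>
    have hv' : symLift (A⁻¹ : GL (Fin 3) F).1 v ≠ 0 := by
      simpa using (symLift_injective A⁻¹).ne hv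
    rw [alpha_smul_mk _ hv hv', mk_mem_points, mk_mem_points, Submodule.mem_map]
    constructor
    · exact fun h => ⟨_, h, symLift_apply_inv A v⟩
    · rintro ⟨w, hw, rfl⟩
      rwa [symLift_inv_apply]

/-- Two subspaces are congruent if some `M ↦ A M Aᵀ` maps the first onto the second. -/
def IsCongruent (W W' : Submodule F (Fin 6 → F)) : Prop :=
  ∃ A : GL (Fin 3) F, W.map (symLift A.1) = W'

theorem IsCongruent.symm {W W' : Submodule F (Fin 6 → F)} (h : IsCongruent W W') :
    IsCongruent W' W := by
  obtain ⟨A, rfl⟩ := h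
  refine ⟨A⁻¹, ?_⟩
  rw [← Submodule.map_comp, ← symLift_mul, ← Units.val_mul, inv_mul_cancel, Units.val_one,
    symLift_one, Submodule.map_id]

theorem IsCongruent.trans {W W' W'' : Submodule F (Fin 6 → F)} (h : IsCongruent W W')
    (h' : IsCongruent W' W'') : IsCongruent W W'' := by
  obtain ⟨A, rfl⟩ := h
  obtain ⟨B, rfl⟩ := h'
  exact ⟨B * A, by rw [Units.val_mul, symLift_mul, Submodule.map_comp]⟩

/-- A congruence is injective, so equality of dimensions turns inclusion of the image into equality.
Explicit congruences below therefore need only one inclusion, checked on coordinates. -/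
theorem isCongruent_of_forall_mem {W W' : Submodule F (Fin 6 → F)}
    (A : Matrix (Fin 3) (Fin 3) F) (hA : A.det ≠ 0) (h : ∀ y ∈ W, symLift A y ∈ W')
    (hr : Module.finrank F W = Module.finrank F W') : IsCongruent W W' := by
  refine ⟨Matrix.GeneralLinearGroup.mkOfDetNeZero A hA, ?_⟩
  refine Submodule.eq_of_le_of_finrank_eq ?_ ?_
  · rintro _ ⟨y, hy, rfl⟩
    exact h y hy
  · rw [← hr]
    exact (Submodule.equivMapOfInjective _ (symLift_injective _) W).finrank_eq.symm

theorem IsCongruent.finrank_eq {W W' : Submodule F (Fin 6 → F)} (h : IsCongruent W W') :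
    Module.finrank F W = Module.finrank F W' := by
  obtain ⟨A, rfl⟩ := h
  exact (Submodule.equivMapOfInjective _ (symLift_injective A) W).finrank_eq

/-- Every element of K lifts to some A in GL(3), and A acts on `points W` through its linear action
on W. -/
theorem mem_orbit_points_iff {W : Submodule F (Fin 6 → F)} {S : Set (PG5 F)} :
    S ∈ MulAction.orbit (K F) (points W) ↔ ∃ W', IsCongruent W W' ∧ S = points W' := by
  constructor
  · rintro ⟨⟨_, g, rfl⟩, rfl⟩
    obtain ⟨A, rfl⟩ := Matrix.ProjGenLinGroup.mk_surjective g
    exact ⟨_, ⟨A, rfl⟩, alpha_smul_points A W⟩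
  · rintro ⟨_, ⟨A, rfl⟩, rfl⟩
    exact ⟨⟨_, Matrix.ProjGenLinGroup.mk A, rfl⟩, alpha_smul_points A W⟩

theorem points_mem_orbit_iff {W W' : Submodule F (Fin 6 → F)} :
    points W' ∈ MulAction.orbit (K F) (points W) ↔ IsCongruent W W' := by
  rw [mem_orbit_points_iff]
  constructor
  · rintro ⟨_, h, h'⟩
    rwa [points_injective h']
  · exact fun h => ⟨_, h, rfl⟩

theorem orbit_points_eq_iff {W W' : Submodule F (Fin 6 → F)} :
    MulAction.orbit (K F) (points W) = MulAction.orbit (K F) (points W') ↔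
      IsCongruent W W' := by
  rw [MulAction.orbit_eq_iff, points_mem_orbit_iff]
  exact ⟨IsCongruent.symm, IsCongruent.symm⟩

theorem isPlane_iff {S : Set (PG5 F)} :
    IsPlane S ↔ ∃ W : Submodule F (Fin 6 → F), Module.finrank F W = 3 ∧ S = points W :=
  Iff.rfl

/-- Counting the orbits of planes by a system of representatives. -/
theorem ncard_disjointPlaneOrbits {ι : Type*} {c : Set (PG5 F) → Prop}
    (W : ι → Submodule F (Fin 6 → F)) (d : Set (PG5 F) → Prop)
    (hd : ∀ U U', IsCongruent U U' → (d (points U) ↔ d (points U')))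
    (hW : ∀ i, Module.finrank F (W i) = 3) (hWs : ∀ i, points (W i) ∩ surface F = ∅)
    (hWc : ∀ i, c (points (W i)))
    (hex : ∀ U : Submodule F (Fin 6 → F), Module.finrank F U = 3 → points U ∩ surface F = ∅ → c (points U) →
      ∃ i, IsCongruent (W i) U)
    (hinj : ∀ i j, IsCongruent (W i) (W j) → i = j) :
    (disjointPlaneOrbits fun π => c π ∧ d π).ncard = {i | d (points (W i))}.ncard := by
  have : (disjointPlaneOrbits fun π => c π ∧ d π) =
      (fun i => MulAction.orbit (K F) (points (W i))) '' {i | d (points (W i))} := by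
    ext O
    constructor
    · rintro ⟨π, hπ, hs, ⟨hc, hdπ⟩, rfl⟩
      obtain ⟨U, hU, rfl⟩ := isPlane_iff.1 hπ
      obtain ⟨i, hi⟩ := hex U hU hs hc
      exact ⟨i, (hd _ _ hi).2 hdπ, orbit_points_eq_iff.2 hi⟩
    · rintro ⟨i, hi, rfl⟩
      exact ⟨_, isPlane_iff.2 ⟨_, hW i, rfl⟩, hWs i, ⟨hWc i, hi⟩, rfl⟩
  rw [this]
  refine Set.ncard_image_of_injective _ fun i j hij => hinj i j ?_
  exact orbit_points_eq_iff.1 hij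

end Action

/-! ### Rank of a symmetric matrix. -/

section Rank

variable {F : Type*} [Field F]

theorem symMatrix_ne_zero {y : Fin 6 → F} (hy : y ≠ 0) : symMatrix y ≠ 0 := by
  intro h
  apply hy
  rw [← symCoords_symMatrix y, h]
  ext i
  fin_cases i <;> rfl

theorem rank_eq_three_iff (y : Fin 6 → F) : (symMatrix y).rank = 3 ↔ (symMatrix y).det ≠ 0 := by
  rw [← isUnit_iff_ne_zero, ← Matrix.isUnit_iff_isUnit_det]
  constructor
  · intro h
    rw [← Matrix.mulVec_surjective_iff_isUnit]
    have h' : LinearMap.range (symMatrix y).mulVecLin = ⊤ :=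
      Submodule.eq_top_of_finrank_eq (by rw [Module.finrank_fin_fun]; exact h)
    exact LinearMap.range_eq_top.1 h'
  · intro h
    simpa using Matrix.rank_of_isUnit _ h

theorem rank_ne_zero {y : Fin 6 → F} (hy : y ≠ 0) : (symMatrix y).rank ≠ 0 := by
  intro h
  apply symMatrix_ne_zero hy
  have h' : LinearMap.range (symMatrix y).mulVecLin = ⊥ := Submodule.finrank_eq_zero.1 h
  rw [LinearMap.range_eq_bot] at h'
  have := congrArg LinearMap.toMatrix' h'
  rwa [← Matrix.toLin'_apply', LinearMap.toMatrix'_toLin', map_zero] at this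

theorem rank_le_three (y : Fin 6 → F) : (symMatrix y).rank ≤ 3 := by
  simpa using (symMatrix y).rank_le_width

/-- The `2 × 2` minors of a symmetric matrix of rank one vanish. -/
theorem minors_of_rank_eq_one {y : Fin 6 → F} (h : (symMatrix y).rank = 1) (i j k l : Fin 3) :
    symMatrix y i j * symMatrix y k l = symMatrix y i l * symMatrix y k j := by
  obtain ⟨⟨v, _⟩, -, hv⟩ := finrank_eq_one_iff'.1 h
  have hc : ∀ j, ∃ c : F, ∀ i, symMatrix y i j = c * v i := by
    intro j
    obtain ⟨c, hc⟩ := hv ⟨(symMatrix y).mulVecLin (Pi.single j 1), LinearMap.mem_range_self _ _⟩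
    refine ⟨c, fun i => ?_⟩
    have := congrFun (congrArg Subtype.val hc) i
    simpa using this.symm
  choose c hc using hc
  rw [hc, hc, hc, hc]
  ring

end Rank

/-! ### Determinants and square roots in characteristic two. -/

section CharTwo

variable {F : Type*} [Field F] [CharP F 2]

/-- The term 2y₁y₂y₄ vanishes and signs disappear. On the hyperplane y₅ = 0 only y₀y₄² + y₃y₂² is
left, which drives all the counts for planes meeting the nucleus plane in a point. -/
theorem det_symMatrix (y : Fin 6 → F) : (symMatrix y).det =
    y 0 * y 3 * y 5 + y 0 * y 4 ^ 2 + y 3 * y 2 ^ 2 + y 5 * y 1 ^ 2 := by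
  have h2 : (2 : F) = 0 := CharTwo.two_eq_zero
  simp only [symMatrix, Matrix.det_fin_three, Matrix.of_apply, Matrix.cons_val', Matrix.cons_val_zero,
    Matrix.cons_val_one, Matrix.cons_val]
  linear_combination (y 1 * y 4 * y 2 - y 0 * y 4 ^ 2 - y 3 * y 2 ^ 2 - y 5 * y 1 ^ 2) * h2

theorem eq_of_sq_eq_sq {a b : F} (h : a ^ 2 = b ^ 2) : a = b := CharTwo.sq_injective h

theorem exists_sq_eq [Finite F] (a : F) : ∃ b : F, b ^ 2 = a := by
  obtain ⟨b, hb⟩ := FiniteField.isSquare_of_char_two (ringChar.eq F 2) a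
  exact ⟨b, by rw [hb, sq]⟩

/-- Square roots of the diagonal give u. The vanishing minors say that the square of each
off-diagonal entry is a product of two diagonal entries, and squaring is injective. -/
theorem exists_eq_veroneseVec_of_rank_eq_one [Finite F] {y : Fin 6 → F} (hy : y ≠ 0)
    (h : (symMatrix y).rank = 1) : ∃ u ≠ 0, y = veroneseVec u := by
  obtain ⟨a, ha⟩ := exists_sq_eq (y 0)
  obtain ⟨b, hb⟩ := exists_sq_eq (y 3)
  obtain ⟨c, hc⟩ := exists_sq_eq (y 5)
  have h1 : y 0 * y 3 = y 1 * y 1 := minors_of_rank_eq_one h 0 0 1 1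
  have h2 : y 0 * y 5 = y 2 * y 2 := minors_of_rank_eq_one h 0 0 2 2
  have h3 : y 3 * y 5 = y 4 * y 4 := minors_of_rank_eq_one h 1 1 2 2
  have hv : y = veroneseVec ![a, b, c] := by
    ext i
    fin_cases i
    · simp [veroneseVec, ha]
    · refine eq_of_sq_eq_sq ?_
      simp [veroneseVec]
      rw [mul_pow, ha, hb, h1, sq]
    · refine eq_of_sq_eq_sq ?_
      simp [veroneseVec]
      rw [mul_pow, ha, hc, h2, sq]
    · simp [veroneseVec, hb]
    · refine eq_of_sq_eq_sq ?_
      simp [veroneseVec]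
      rw [mul_pow, hb, hc, h3, sq]
    · simp [veroneseVec, hc]
  refine ⟨_, ?_, hv⟩
  rintro h0
  apply hy
  rw [hv, h0]
  ext i
  fin_cases i <;> simp [veroneseVec]

end CharTwo

/-! ### The Veronese surface and the nucleus plane in terms of vectors. -/

section Surface

variable {F : Type*} [Field F]

theorem veroneseVec_smul (c : F) (u : Fin 3 → F) :
    veroneseVec (c • u) = (c ^ 2) • veroneseVec u := by
  ext i
  fin_cases i <;> simp [veroneseVec] <;> ring

theorem points_inter_surface_eq_empty_iff {W : Submodule F (Fin 6 → F)} :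
    points W ∩ surface F = ∅ ↔ ∀ u : Fin 3 → F, u ≠ 0 → veroneseVec u ∉ W := by
  constructor
  · intro h u hu hm
    set p : PG2 F := Projectivization.mk F u hu with hp
    have hmem : veronese p ∈ points W := by
      rw [veronese, mk_mem_points]
      obtain ⟨c, hc⟩ := Projectivization.exists_smul_eq_mk_rep F u hu
      have : p.rep = (c : F) • u := hc.symm
      rw [this, veroneseVec_smul]
      exact W.smul_mem _ hm
    exact Set.eq_empty_iff_forall_notMem.1 h _ ⟨hmem, p, rfl⟩
  · rintro h
    refine Set.eq_empty_iff_forall_notMem.2 ?_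
    rintro _ ⟨hm, p, rfl⟩
    rw [veronese, mk_mem_points] at hm
    exact h _ p.rep_nonzero hm

/-- The symmetric matrices with zero diagonal. -/
def zeroDiag (F : Type*) [Field F] : Submodule F (Fin 6 → F) where
  carrier := {y | y 0 = 0 ∧ y 3 = 0 ∧ y 5 = 0}
  add_mem' := by
    rintro a b ⟨h1, h2, h3⟩ ⟨h4, h5, h6⟩
    simp [h1, h2, h3, h4, h5, h6]
  zero_mem' := by simp
  smul_mem' := by
    rintro c a ⟨h1, h2, h3⟩
    simp [h1, h2, h3]

theorem mem_zeroDiag {y : Fin 6 → F} : y ∈ zeroDiag F ↔ y 0 = 0 ∧ y 3 = 0 ∧ y 5 = 0 := Iff.rfl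

theorem nucleusPlane_eq : nucleusPlane F = points (zeroDiag F) := by
  ext P
  rw [mem_points]
  rfl

end Surface

/-! ### Counting projective points by vectors. -/

section Counting

variable {F : Type*} [Field F]

/-- Each vector of the cone S is, in exactly one way, a unit times the chosen representative of its
point. -/
theorem ncard_setOf_rep_mem [Finite F] {S : Set (Fin 6 → F)} (h0 : 0 ∉ S)
    (hS : ∀ c : F, c ≠ 0 → ∀ v ∈ S, c • v ∈ S) :
    {P : PG5 F | P.rep ∈ S}.ncard * (Nat.card F - 1) = S.ncard := by
  have himg : (fun x : PG5 F × Fˣ => (x.2 : F) • x.1.rep) '' ({P : PG5 F | P.rep ∈ S} ×ˢ Set.univ)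
      = S := by
    ext v
    constructor
    · rintro ⟨⟨P, u⟩, ⟨hP, -⟩, rfl⟩
      exact hS _ u.ne_zero _ hP
    · intro hv
      have hv0 : v ≠ 0 := fun h => h0 (h ▸ hv)
      obtain ⟨c, hc⟩ := Projectivization.exists_smul_eq_mk_rep F v hv0
      refine ⟨(Projectivization.mk F v hv0, c⁻¹), ⟨?_, trivial⟩, ?_⟩
      · change (Projectivization.mk F v hv0).rep ∈ S
        rw [← hc]
        exact hS _ c.ne_zero _ hv
      · change ((c⁻¹ : Fˣ) : F) • (Projectivization.mk F v hv0).rep = v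
        rw [← hc, ← Units.smul_def, inv_smul_smul]
  have hinj : Function.Injective (fun x : PG5 F × Fˣ => (x.2 : F) • x.1.rep) := by
    rintro ⟨P, u⟩ ⟨Q, w⟩ h
    simp only at h
    have hPQ : P = Q := by
      rw [← P.mk_rep, ← Q.mk_rep, Projectivization.mk_eq_mk_iff]
      refine ⟨u⁻¹ * w, ?_⟩
      rw [mul_smul, Units.smul_def w, ← h, ← Units.smul_def, inv_smul_smul]
    subst hPQ
    simpa [Units.ext_iff] using smul_left_injective F P.rep_nonzero h
  conv_rhs => rw [← himg]
  rw [Set.ncard_image_of_injective _ hinj, Set.ncard_prod, Set.ncard_univ,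
    Nat.card_units]

theorem ncard_points [Finite F] (W : Submodule F (Fin 6 → F)) :
    (points W).ncard * (Nat.card F - 1) = Nat.card F ^ Module.finrank F W - 1 := by
  have h : points W = {P : PG5 F | P.rep ∈ (W : Set (Fin 6 → F)) \ {0}} := by
    ext P
    simp [mem_points, P.rep_nonzero]
  rw [h, ncard_setOf_rep_mem (by simp), Set.ncard_sdiff (by simp), Set.ncard_singleton]
  · congr 1
    rw [← Module.natCard_eq_pow_finrank (K := F) (V := W)]
    rfl
  · rintro c hc v ⟨hv, hv0⟩
    exact ⟨W.smul_mem c hv, by simpa [hc] using hv0⟩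

end Counting

/-! ### Invariance of rank, nucleus plane and distribution under congruence. -/

section Invariance

variable {F : Type*} [Field F]

theorem pointRank_mk {v : Fin 6 → F} (hv : v ≠ 0) :
    pointRank (Projectivization.mk F v hv) = (symMatrix v).rank := by
  obtain ⟨c, hc⟩ := Projectivization.exists_smul_eq_mk_rep F v hv
  have h : symMatrix ((c : F) • v) = (c : F) • symMatrix v := by
    ext i j
    fin_cases i <;> fin_cases j <;> simp [symMatrix]
  rw [pointRank, ← hc, Units.smul_def, h]
  exact Matrix.rank_smul_of_mem_nonZeroDivisors _ (mem_nonZeroDivisors_of_ne_zero c.ne_zero)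

theorem rank_symLift (A : GL (Fin 3) F) (v : Fin 6 → F) :
    (symMatrix (symLift A.1 v)).rank = (symMatrix v).rank := by
  have hA : IsUnit (A : Matrix (Fin 3) (Fin 3) F).det :=
    (Matrix.isUnit_iff_isUnit_det _).1 A.isUnit
  rw [symMatrix_symLift, Matrix.rank_mul_eq_left_of_isUnit_det _ _
    (by rwa [Matrix.det_transpose]), Matrix.rank_mul_eq_right_of_isUnit_det _ _ hA]

theorem pointRank_alpha_smul (A : GL (Fin 3) F) (P : PG5 F) :
    pointRank (alpha (Matrix.ProjGenLinGroup.mk A) • P) = pointRank P := by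
  induction P using Projectivization.ind with
  | h v hv =>
    have hv' : symLift A.1 v ≠ 0 := by simpa using (symLift_injective A).ne hv
    rw [alpha_smul_mk _ hv hv', pointRank_mk, pointRank_mk, rank_symLift]

/-- The off-diagonal part is kept as a multiple of 2: in characteristic two a new diagonal entry
depends on the old diagonal alone, weighted by the squares of a row of A. -/
theorem symLift_apply_zero (A : Matrix (Fin 3) (Fin 3) F) (y : Fin 6 → F) : symLift A y 0 =
    A 0 0 ^ 2 * y 0 + A 0 1 ^ 2 * y 3 + A 0 2 ^ 2 * y 5 +
      2 * (A 0 0 * A 0 1 * y 1 + A 0 0 * A 0 2 * y 2 + A 0 1 * A 0 2 * y 4) := by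
  simp [symLift, symCoords, symMatrix, Matrix.mul_apply, Fin.sum_univ_three]
  ring

theorem symLift_apply_three (A : Matrix (Fin 3) (Fin 3) F) (y : Fin 6 → F) : symLift A y 3 =
    A 1 0 ^ 2 * y 0 + A 1 1 ^ 2 * y 3 + A 1 2 ^ 2 * y 5 +
      2 * (A 1 0 * A 1 1 * y 1 + A 1 0 * A 1 2 * y 2 + A 1 1 * A 1 2 * y 4) := by
  simp [symLift, symCoords, symMatrix, Matrix.mul_apply, Fin.sum_univ_three]
  ring

theorem symLift_apply_five (A : Matrix (Fin 3) (Fin 3) F) (y : Fin 6 → F) : symLift A y 5 =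
    A 2 0 ^ 2 * y 0 + A 2 1 ^ 2 * y 3 + A 2 2 ^ 2 * y 5 +
      2 * (A 2 0 * A 2 1 * y 1 + A 2 0 * A 2 2 * y 2 + A 2 1 * A 2 2 * y 4) := by
  simp [symLift, symCoords, symMatrix, Matrix.mul_apply, Fin.sum_univ_three]
  ring

theorem symLift_apply_one (A : Matrix (Fin 3) (Fin 3) F) (y : Fin 6 → F) : symLift A y 1 =
    A 0 0 * A 1 0 * y 0 + A 0 1 * A 1 1 * y 3 + A 0 2 * A 1 2 * y 5 +
      (A 0 0 * A 1 1 + A 0 1 * A 1 0) * y 1 + (A 0 0 * A 1 2 + A 0 2 * A 1 0) * y 2 +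
      (A 0 1 * A 1 2 + A 0 2 * A 1 1) * y 4 := by
  simp [symLift, symCoords, symMatrix, Matrix.mul_apply, Fin.sum_univ_three]
  ring

theorem symLift_apply_two (A : Matrix (Fin 3) (Fin 3) F) (y : Fin 6 → F) : symLift A y 2 =
    A 0 0 * A 2 0 * y 0 + A 0 1 * A 2 1 * y 3 + A 0 2 * A 2 2 * y 5 +
      (A 0 0 * A 2 1 + A 0 1 * A 2 0) * y 1 + (A 0 0 * A 2 2 + A 0 2 * A 2 0) * y 2 +
      (A 0 1 * A 2 2 + A 0 2 * A 2 1) * y 4 := by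
  simp [symLift, symCoords, symMatrix, Matrix.mul_apply, Fin.sum_univ_three]
  ring

theorem symLift_apply_four (A : Matrix (Fin 3) (Fin 3) F) (y : Fin 6 → F) : symLift A y 4 =
    A 1 0 * A 2 0 * y 0 + A 1 1 * A 2 1 * y 3 + A 1 2 * A 2 2 * y 5 +
      (A 1 0 * A 2 1 + A 1 1 * A 2 0) * y 1 + (A 1 0 * A 2 2 + A 1 2 * A 2 0) * y 2 +
      (A 1 1 * A 2 2 + A 1 2 * A 2 1) * y 4 := by
  simp [symLift, symCoords, symMatrix, Matrix.mul_apply, Fin.sum_univ_three]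
  ring

theorem symLift_veroneseVec (A : Matrix (Fin 3) (Fin 3) F) (u : Fin 3 → F) :
    symLift A (veroneseVec u) = veroneseVec (A.mulVec u) := by
  ext i
  fin_cases i <;> simp [symLift, symCoords, symMatrix, veroneseVec, Matrix.mul_apply,
    Matrix.mulVec, dotProduct, Fin.sum_univ_three] <;> ring

theorem points_map_inter_surface (A : GL (Fin 3) F) {W : Submodule F (Fin 6 → F)}
    (h : points W ∩ surface F = ∅) : points (W.map (symLift A.1)) ∩ surface F = ∅ := by
  rw [points_inter_surface_eq_empty_iff] at h ⊢
  rintro u hu ⟨w, hw, hwu⟩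
  refine h ((A⁻¹ : GL (Fin 3) F).1.mulVec u) ?_ ?_
  · intro h0
    apply hu
    have := congrArg A.1.mulVec h0
    rwa [Matrix.mulVec_mulVec, ← Units.val_mul, mul_inv_cancel, Units.val_one, Matrix.one_mulVec,
      Matrix.mulVec_zero] at this
  · rwa [← symLift_veroneseVec, ← hwu, symLift_inv_apply]

theorem IsCongruent.inter_surface {W W' : Submodule F (Fin 6 → F)} (hc : IsCongruent W W')
    (h : points W ∩ surface F = ∅) : points W' ∩ surface F = ∅ := by
  obtain ⟨A, rfl⟩ := hc
  exact points_map_inter_surface A h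

variable [CharP F 2]

/-- Off-diagonal entries enter the new diagonal only with a factor 2. This is why the nucleus plane
is K-invariant. -/
theorem symLift_mem_zeroDiag (A : Matrix (Fin 3) (Fin 3) F) {y : Fin 6 → F}
    (hy : y ∈ zeroDiag F) : symLift A y ∈ zeroDiag F := by
  have h2 : (2 : F) = 0 := CharTwo.two_eq_zero
  obtain ⟨h0, h3, h5⟩ := hy
  refine ⟨?_, ?_, ?_⟩
  · rw [symLift_apply_zero, h0, h3, h5, h2]; ring
  · rw [symLift_apply_three, h0, h3, h5, h2]; ring
  · rw [symLift_apply_five, h0, h3, h5, h2]; ring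

theorem symLift_mem_zeroDiag_iff (A : GL (Fin 3) F) {y : Fin 6 → F} :
    symLift A.1 y ∈ zeroDiag F ↔ y ∈ zeroDiag F := by
  refine ⟨fun h => ?_, symLift_mem_zeroDiag _⟩
  rw [← symLift_inv_apply A y]
  exact symLift_mem_zeroDiag _ h

theorem alpha_smul_mem_nucleusPlane (A : GL (Fin 3) F) (P : PG5 F) :
    alpha (Matrix.ProjGenLinGroup.mk A) • P ∈ nucleusPlane F ↔ P ∈ nucleusPlane F := by
  rw [nucleusPlane_eq]
  induction P using Projectivization.ind with
  | h v hv =>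
    have hv' : symLift A.1 v ≠ 0 := by simpa using (symLift_injective A).ne hv
    rw [alpha_smul_mk _ hv hv', mk_mem_points, mk_mem_points, symLift_mem_zeroDiag_iff]

theorem OD0_alpha_smul (A : GL (Fin 3) F) (S : Set (PG5 F)) :
    OD0 (alpha (Matrix.ProjGenLinGroup.mk A) • S) = OD0 S := by
  set g := alpha (Matrix.ProjGenLinGroup.mk A) with hg
  have key : ∀ p : PG5 F → Prop, (∀ P, p (g • P) ↔ p P) →
      {P | P ∈ g • S ∧ p P}.ncard = {P | P ∈ S ∧ p P}.ncard := by
    intro p hp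
    have : {P | P ∈ g • S ∧ p P} = (g • ·) '' {P | P ∈ S ∧ p P} := by
      ext P
      constructor
      · rintro ⟨⟨Q, hQ, rfl⟩, h⟩
        exact ⟨Q, ⟨hQ, (hp Q).1 h⟩, rfl⟩
      · rintro ⟨Q, ⟨hQ, h⟩, rfl⟩
        exact ⟨⟨Q, hQ, rfl⟩, (hp Q).2 h⟩
    rw [this, Set.ncard_image_of_injective _ (MulAction.injective g)]
  have hr : ∀ P, pointRank (g • P) = pointRank P := pointRank_alpha_smul A
  have hn : ∀ P, g • P ∈ nucleusPlane F ↔ P ∈ nucleusPlane F := alpha_smul_mem_nucleusPlane A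
  have e1 : r1 (g • S) = r1 S := key _ fun P => by rw [hr]
  have e4 : r3 (g • S) = r3 S := key _ fun P => by rw [hr]
  have e2 : r2n (g • S) = r2n S := by
    have := key (fun P => P ∈ nucleusPlane F ∧ pointRank P = 2) fun P => by rw [hr, hn]
    simpa [r2n, Set.mem_inter_iff, and_assoc] using this
  have e3 : r2s (g • S) = r2s S := by
    have := key (fun P => P ∉ nucleusPlane F ∧ pointRank P = 2) fun P => by rw [hr, hn]
    simpa [r2s, Set.mem_sdiff, and_assoc] using this
  rw [OD0, OD0, e1, e2, e3, e4]

theorem IsCongruent.OD0_eq {W W' : Submodule F (Fin 6 → F)} (h : IsCongruent W W') :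
    OD0 (points W) = OD0 (points W') := by
  obtain ⟨A, rfl⟩ := h
  rw [← alpha_smul_points, OD0_alpha_smul]

theorem map_symLift_inf_zeroDiag (A : GL (Fin 3) F) (W : Submodule F (Fin 6 → F)) :
    W.map (symLift A.1) ⊓ zeroDiag F = (W ⊓ zeroDiag F).map (symLift A.1) := by
  ext y
  constructor
  · rintro ⟨⟨w, hw, rfl⟩, h⟩
    exact ⟨w, ⟨hw, (symLift_mem_zeroDiag_iff A).1 h⟩, rfl⟩
  · rintro ⟨w, ⟨hw, h⟩, rfl⟩
    exact ⟨⟨w, hw, rfl⟩, (symLift_mem_zeroDiag_iff A).2 h⟩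

theorem IsCongruent.inf_zeroDiag {W W' : Submodule F (Fin 6 → F)} (h : IsCongruent W W') :
    IsCongruent (W ⊓ zeroDiag F) (W' ⊓ zeroDiag F) := by
  obtain ⟨A, rfl⟩ := h
  exact ⟨A, (map_symLift_inf_zeroDiag A W).symm⟩

end Invariance

/-! ### The distribution of a plane disjoint from the surface. -/

section Distribution

variable {F : Type*} [Field F] [Finite F]

theorem card_sub_one_pos : 0 < Nat.card F - 1 := Nat.sub_pos_of_lt Finite.one_lt_card

theorem ncard_points_of_finrank_eq_three {W : Submodule F (Fin 6 → F)}
    (h : Module.finrank F W = 3) :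
    (points W).ncard = Nat.card F ^ 2 + Nat.card F + 1 := by
  apply Nat.eq_of_mul_eq_mul_right (card_sub_one_pos (F := F))
  rw [ncard_points, h]
  -- Writing q = n + 1 removes the truncated subtraction from (q² + q + 1)(q - 1) = q³ - 1.
  obtain ⟨n, hn⟩ : ∃ n, Nat.card F = n + 1 := ⟨_, (Nat.succ_pred_eq_of_pos Nat.card_pos).symm⟩
  rw [hn, Nat.add_sub_cancel]
  exact Nat.sub_eq_of_eq_add (by ring)

theorem ncard_points_of_finrank_eq_two {W : Submodule F (Fin 6 → F)}
    (h : Module.finrank F W = 2) : (points W).ncard = Nat.card F + 1 := by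
  apply Nat.eq_of_mul_eq_mul_right (card_sub_one_pos (F := F))
  rw [ncard_points, h]
  obtain ⟨n, hn⟩ : ∃ n, Nat.card F = n + 1 := ⟨_, (Nat.succ_pred_eq_of_pos Nat.card_pos).symm⟩
  rw [hn, Nat.add_sub_cancel]
  exact Nat.sub_eq_of_eq_add (by ring)

theorem ncard_points_eq_one_iff {W : Submodule F (Fin 6 → F)} :
    (points W).ncard = 1 ↔ Module.finrank F W = 1 := by
  have hq : 1 < Nat.card F := Finite.one_lt_card
  have h := ncard_points W
  constructor
  · intro h1
    rw [h1, one_mul] at h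
    have hp : 0 < Nat.card F ^ Module.finrank F W := Nat.pow_pos (by omega)
    have h' : Nat.card F ^ Module.finrank F W = Nat.card F ^ 1 := by rw [pow_one]; omega
    exact Nat.pow_right_injective hq h'
  · intro h1
    rw [h1, pow_one] at h
    exact Nat.eq_of_mul_eq_mul_right (card_sub_one_pos (F := F)) (by rw [h, one_mul])

variable [CharP F 2]

theorem pointRank_eq_two_or_three {W : Submodule F (Fin 6 → F)}
    (hs : points W ∩ surface F = ∅) {P : PG5 F} (hP : P ∈ points W) :
    pointRank P = 2 ∨ pointRank P = 3 := by
  have h0 : pointRank P ≠ 0 := rank_ne_zero P.rep_nonzero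
  have h3 : pointRank P ≤ 3 := rank_le_three _
  have h1 : pointRank P ≠ 1 := by
    intro h1
    obtain ⟨u, hu, h⟩ := exists_eq_veroneseVec_of_rank_eq_one P.rep_nonzero h1
    exact points_inter_surface_eq_empty_iff.1 hs u hu (h ▸ mem_points.1 hP)
  omega

/-- The point-orbit distribution of a plane disjoint from the Veronese surface. -/
theorem OD0_points {W : Submodule F (Fin 6 → F)} (hW : Module.finrank F W = 3)
    (hs : points W ∩ surface F = ∅) {a b : ℕ}
    (ha : (points (W ⊓ zeroDiag F)).ncard = a)
    (hb : {y | y ∈ W ∧ y ∉ zeroDiag F ∧ (symMatrix y).det = 0}.ncard = b * (Nat.card F - 1)) :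
    OD0 (points W) = ![0, a, b, Nat.card F ^ 2 + Nat.card F + 1 - a - b] := by
  have hrank : ∀ P ∈ points W, pointRank P = 2 ∨ pointRank P = 3 := fun P hP =>
    pointRank_eq_two_or_three hs hP
  have hdet : ∀ P ∈ points W, (pointRank P = 2 ↔ (symMatrix P.rep).det = 0) := by
    intro P hP
    have h3 : pointRank P = 3 ↔ _ := rank_eq_three_iff P.rep
    rcases hrank P hP with h | h
    · have : ¬ pointRank P = 3 := by omega
      rw [h3, not_not] at this
      exact ⟨fun _ => this, fun _ => h⟩
    · exact ⟨fun h' => by omega, fun h' => absurd h' (h3.1 h)⟩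
  -- Zero-diagonal matrices are alternating of odd order, hence singular.
  have hn : ∀ P ∈ nucleusPlane F, (symMatrix P.rep).det = 0 := by
    rintro P ⟨h0, h3, h5⟩
    rw [det_symMatrix, h0, h3, h5]
    ring
  have e1 : r1 (points W) = 0 := by
    rw [r1, Set.ncard_eq_zero (Set.toFinite _), Set.eq_empty_iff_forall_notMem]
    rintro P ⟨hP, h1⟩
    have := hrank P hP
    omega
  have e2s : {P ∈ points W ∩ nucleusPlane F | pointRank P = 2} = points (W ⊓ zeroDiag F) := by
    rw [points_inf, ← nucleusPlane_eq]
    ext P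
    exact ⟨fun h => h.1, fun h => ⟨h, (hdet P h.1).2 (hn P h.2)⟩⟩
  have e2 : r2n (points W) = a := by rw [r2n, e2s, ha]
  have e3s : {P ∈ points W \ nucleusPlane F | pointRank P = 2} =
      {P : PG5 F | P.rep ∈ {y | y ∈ W ∧ y ∉ zeroDiag F ∧ (symMatrix y).det = 0}} := by
    ext P
    simp only [Set.mem_ofPred_eq, Set.mem_sdiff, nucleusPlane_eq, mem_points]
    constructor
    · rintro ⟨⟨h1, h2⟩, h3⟩
      exact ⟨h1, h2, (hdet P (mem_points.2 h1)).1 h3⟩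
    · rintro ⟨h1, h2, h3⟩
      exact ⟨⟨h1, h2⟩, (hdet P (mem_points.2 h1)).2 h3⟩
  have e3 : r2s (points W) = b := by
    apply Nat.eq_of_mul_eq_mul_right (card_sub_one_pos (F := F))
    rw [r2s, e3s, ncard_setOf_rep_mem, hb]
    · rintro ⟨-, h, -⟩
      exact h (Submodule.zero_mem _)
    · rintro c hc v ⟨h1, h2, h3⟩
      refine ⟨W.smul_mem c h1, fun h => h2 ?_, ?_⟩
      · exact ((zeroDiag F).smul_mem_iff hc).1 h
      · rw [det_symMatrix] at h3 ⊢
        simp only [Pi.smul_apply, smul_eq_mul]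
        linear_combination c ^ 3 * h3
  have hsplit : points W = {P ∈ points W ∩ nucleusPlane F | pointRank P = 2} ∪
      {P ∈ points W \ nucleusPlane F | pointRank P = 2} ∪ {P ∈ points W | pointRank P = 3} := by
    ext P
    have := hrank P
    simp only [Set.mem_union, Set.mem_ofPred_eq, Set.mem_inter_iff, Set.mem_sdiff]
    tauto
  have e4 : r3 (points W) = Nat.card F ^ 2 + Nat.card F + 1 - a - b := by
    have hcard := ncard_points_of_finrank_eq_three hW
    rw [hsplit, Set.ncard_union_eq, Set.ncard_union_eq] at hcard
    · change r2n (points W) + r2s (points W) + r3 (points W) = _ at hcard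
      omega
    · rw [Set.disjoint_left]
      rintro P ⟨⟨-, h⟩, -⟩ ⟨⟨-, h'⟩, -⟩
      exact h' h
    · rw [Set.disjoint_left]
      rintro P (⟨-, h⟩ | ⟨-, h⟩) ⟨-, h'⟩ <;> omega
  rw [OD0, e1, e2, e3, e4]

end Distribution

/-! ### Three parametrised families of planes. -/

section Families

variable {F : Type*} [Field F]

/-- The parametrisation of the matrices `[[ta, x, tc], [x, tb, y], [tc, y, te]]`. -/
def lineParam (a b e c : F) : (F × F × F) →ₗ[F] (Fin 6 → F) where
  toFun p := ![p.1 * a, p.2.1, p.1 * c, p.1 * b, p.2.2, p.1 * e]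
  map_add' p p' := by
    ext i
    fin_cases i <;> simp [add_mul]
  map_smul' s p := by
    ext i
    fin_cases i <;> simp [mul_assoc]

/-- The parametrisation of the matrices `[[x, z, αx+βy], [z, y, γx+δy], [αx+βy, γx+δy, 0]]`. -/
def cubicParam (α β γ δ : F) : (F × F × F) →ₗ[F] (Fin 6 → F) where
  toFun p := ![p.1, p.2.2, α * p.1 + β * p.2.1, p.2.1, γ * p.1 + δ * p.2.1, 0]
  map_add' p p' := by
    ext i
    fin_cases i <;> simp <;> ring
  map_smul' s p := by
    ext i
    fin_cases i <;> simp <;> ring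

/-- The parametrisation of the matrices `[[x, αx+βy, z], [αx+βy, y, γx+δy], [z, γx+δy, 0]]`. -/
def conicParam (α β γ δ : F) : (F × F × F) →ₗ[F] (Fin 6 → F) where
  toFun p := ![p.1, α * p.1 + β * p.2.1, p.2.2, p.2.1, γ * p.1 + δ * p.2.1, 0]
  map_add' p p' := by
    ext i
    fin_cases i <;> simp <;> ring
  map_smul' s p := by
    ext i
    fin_cases i <;> simp <;> ring

/-- The matrices `[[ta, x, tc], [x, tb, y], [tc, y, te]]`. -/
def lineFamily (a b e c : F) : Submodule F (Fin 6 → F) := LinearMap.range (lineParam a b e c)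

/-- The matrices `[[x, z, αx+βy], [z, y, γx+δy], [αx+βy, γx+δy, 0]]`. -/
def cubicFamily (α β γ δ : F) : Submodule F (Fin 6 → F) := LinearMap.range (cubicParam α β γ δ)

/-- The matrices `[[x, αx+βy, z], [αx+βy, y, γx+δy], [z, γx+δy, 0]]`. -/
def conicFamily (α β γ δ : F) : Submodule F (Fin 6 → F) := LinearMap.range (conicParam α β γ δ)

theorem mem_lineFamily {a b e c : F} {y : Fin 6 → F} : y ∈ lineFamily a b e c ↔
    ∃ t, y 0 = t * a ∧ y 3 = t * b ∧ y 5 = t * e ∧ y 2 = t * c := by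
  constructor
  · rintro ⟨p, rfl⟩
    exact ⟨p.1, rfl, rfl, rfl, rfl⟩
  · rintro ⟨t, h0, h3, h5, h2⟩
    refine ⟨(t, y 1, y 4), ?_⟩
    ext i
    fin_cases i <;> simp [lineParam, *]

theorem mem_cubicFamily {α β γ δ : F} {y : Fin 6 → F} : y ∈ cubicFamily α β γ δ ↔
    y 5 = 0 ∧ y 2 = α * y 0 + β * y 3 ∧ y 4 = γ * y 0 + δ * y 3 := by
  constructor
  · rintro ⟨p, rfl⟩
    exact ⟨rfl, rfl, rfl⟩
  · rintro ⟨h5, h2, h4⟩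
    refine ⟨(y 0, y 3, y 1), ?_⟩
    ext i
    fin_cases i <;> simp [cubicParam, *]

theorem mem_conicFamily {α β γ δ : F} {y : Fin 6 → F} : y ∈ conicFamily α β γ δ ↔
    y 5 = 0 ∧ y 1 = α * y 0 + β * y 3 ∧ y 4 = γ * y 0 + δ * y 3 := by
  constructor
  · rintro ⟨p, rfl⟩
    exact ⟨rfl, rfl, rfl⟩
  · rintro ⟨h5, h2, h4⟩
    refine ⟨(y 0, y 3, y 2), ?_⟩
    ext i
    fin_cases i <;> simp [conicParam, *]

theorem lineParam_injective {a b e c : F} (h : ¬ (a = 0 ∧ b = 0 ∧ e = 0 ∧ c = 0)) :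
    Function.Injective (lineParam a b e c) := by
  rw [← LinearMap.ker_eq_bot, LinearMap.ker_eq_bot']
  rintro ⟨t, x, y⟩ hp
  have h0 : t * a = 0 := congrFun hp 0
  have h1 : x = 0 := congrFun hp 1
  have h2 : t * c = 0 := congrFun hp 2
  have h3 : t * b = 0 := congrFun hp 3
  have h4 : y = 0 := congrFun hp 4
  have h5 : t * e = 0 := congrFun hp 5
  have ht : t = 0 := by
    by_contra ht
    simp [ht] at h0 h2 h3 h5
    exact h ⟨h0, h3, h5, h2⟩
  rw [ht, h1, h4]
  rfl

theorem cubicParam_injective (α β γ δ : F) : Function.Injective (cubicParam α β γ δ) := by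
  rintro ⟨x, y, z⟩ ⟨x', y', z'⟩ hp
  have h0 : x = x' := congrFun hp 0
  have h1 : z = z' := congrFun hp 1
  have h3 : y = y' := congrFun hp 3
  rw [h0, h1, h3]

theorem conicParam_injective (α β γ δ : F) : Function.Injective (conicParam α β γ δ) := by
  rintro ⟨x, y, z⟩ ⟨x', y', z'⟩ hp
  have h0 : x = x' := congrFun hp 0
  have h1 : z = z' := congrFun hp 2
  have h3 : y = y' := congrFun hp 3
  rw [h0, h1, h3]

theorem finrank_range_of_injective {f : (F × F × F) →ₗ[F] (Fin 6 → F)}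
    (hf : Function.Injective f) : Module.finrank F (LinearMap.range f) = 3 := by
  rw [LinearMap.finrank_range_of_inj hf]
  simp

theorem finrank_lineFamily {a b e c : F} (h : ¬ (a = 0 ∧ b = 0 ∧ e = 0 ∧ c = 0)) :
    Module.finrank F (lineFamily a b e c) = 3 :=
  finrank_range_of_injective (lineParam_injective h)

theorem finrank_cubicFamily (α β γ δ : F) : Module.finrank F (cubicFamily α β γ δ) = 3 :=
  finrank_range_of_injective (cubicParam_injective α β γ δ)

theorem finrank_conicFamily (α β γ δ : F) : Module.finrank F (conicFamily α β γ δ) = 3 :=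
  finrank_range_of_injective (conicParam_injective α β γ δ)

/-- The subspace whose point set is the line of all `[[0, x, 0], [x, 0, y], [0, y, 0]]`. -/
def baseLine (F : Type*) [Field F] : Submodule F (Fin 6 → F) := lineFamily 0 0 0 0

theorem mem_baseLine {y : Fin 6 → F} :
    y ∈ baseLine F ↔ y 0 = 0 ∧ y 3 = 0 ∧ y 5 = 0 ∧ y 2 = 0 := by
  simp [baseLine, mem_lineFamily]

theorem line12_1_eq : line12_1 F = points (baseLine F) := by
  ext P
  rw [mem_points, mem_baseLine]
  constructor
  · rintro ⟨x, y, h⟩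
    have h' := fun i j => congrFun (congrFun h i) j
    exact ⟨h' 0 0, h' 1 1, h' 2 2, h' 0 2⟩
  · rintro ⟨h0, h3, h5, h2⟩
    refine ⟨P.rep 1, P.rep 4, ?_⟩
    rw [symMatrix, h0, h3, h5, h2]

theorem finrank_baseLine : Module.finrank F (baseLine F) = 2 := by
  let f : (F × F) →ₗ[F] (Fin 6 → F) := lineParam 0 0 0 0 ∘ₗ LinearMap.inr F F (F × F)
  have hf : Function.Injective f := by
    rintro ⟨x, y⟩ ⟨x', y'⟩ h
    have h1 : x = x' := congrFun h 1
    have h4 : y = y' := congrFun h 4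
    rw [h1, h4]
  have hr : LinearMap.range f = baseLine F := by
    ext y
    rw [mem_baseLine]
    constructor
    · rintro ⟨p, rfl⟩
      simp [f, lineParam]
    · rintro ⟨h0, h3, h5, h2⟩
      refine ⟨(y 1, y 4), ?_⟩
      ext i
      fin_cases i <;> simp [f, lineParam, *]
  rw [← hr, LinearMap.finrank_range_of_inj hf]
  simp

theorem lineFamily_inf_zeroDiag {a b e c : F} (h : ¬ (a = 0 ∧ b = 0 ∧ e = 0)) :
    lineFamily a b e c ⊓ zeroDiag F = baseLine F := by
  ext y
  rw [Submodule.mem_inf, mem_lineFamily, mem_zeroDiag, mem_baseLine]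
  constructor
  · rintro ⟨⟨t, h0, h3, h5, h2⟩, h0', h3', h5'⟩
    have ht : t = 0 := by
      by_contra ht
      rw [h0'] at h0
      rw [h3'] at h3
      rw [h5'] at h5
      simp [ht] at h0 h3 h5
      exact h ⟨h0, h3, h5⟩
    simp [ht] at h2
    exact ⟨h0', h3', h5', h2⟩
  · rintro ⟨h0, h3, h5, h2⟩
    exact ⟨⟨0, by simp [*]⟩, h0, h3, h5⟩

theorem finrank_cubicFamily_inf_zeroDiag (α β γ δ : F) :
    Module.finrank F ↥(cubicFamily α β γ δ ⊓ zeroDiag F) = 1 := by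
  refine finrank_eq_one_iff'.2 ⟨⟨![0, 1, 0, 0, 0, 0], ?_, ?_⟩, ?_, ?_⟩
  · simp [mem_cubicFamily]
  · simp [mem_zeroDiag]
  · intro h
    simpa using congrFun (congrArg Subtype.val h) 1
  · rintro ⟨y, hy, h0, h3, h5⟩
    obtain ⟨-, h2, h4⟩ := mem_cubicFamily.1 hy
    refine ⟨y 1, Subtype.ext ?_⟩
    ext i
    fin_cases i <;> simp [*]

theorem finrank_conicFamily_inf_zeroDiag (α β γ δ : F) :
    Module.finrank F ↥(conicFamily α β γ δ ⊓ zeroDiag F) = 1 := by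
  refine finrank_eq_one_iff'.2 ⟨⟨![0, 0, 1, 0, 0, 0], ?_, ?_⟩, ?_, ?_⟩
  · simp [mem_conicFamily]
  · simp [mem_zeroDiag]
  · intro h
    simpa using congrFun (congrArg Subtype.val h) 2
  · rintro ⟨y, hy, h0, h3, h5⟩
    obtain ⟨-, h2, h4⟩ := mem_conicFamily.1 hy
    refine ⟨y 2, Subtype.ext ?_⟩
    ext i
    fin_cases i <;> simp [*]

/-- For a surface point, (u₀u₂)² = u₀²u₂² reads t²c² = t²ae. So t = 0, the diagonal vanishes, and u
= 0. -/
theorem lineFamily_inter_surface {a b e c : F} (h : c ^ 2 ≠ a * e) :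
    points (lineFamily a b e c) ∩ surface F = ∅ := by
  rw [points_inter_surface_eq_empty_iff]
  intro u hu hm
  obtain ⟨t, h0, h3, h5, h2⟩ := mem_lineFamily.1 hm
  simp only [veroneseVec, Matrix.cons_val] at h0 h3 h5 h2
  have ht : t = 0 := by
    by_contra ht
    apply h
    have : t ^ 2 * (c ^ 2 - a * e) = 0 := by
      linear_combination (-t * c - u 0 * u 2) * h2 + u 2 ^ 2 * h0 + t * a * h5
    simpa [ht, sub_eq_zero] using this
  subst ht
  simp at h0 h3 h5
  apply hu
  ext i
  fin_cases i <;> simp [*]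

/-- A surface point has u₂ = 0, so (u₀², u₁²) solves a homogeneous linear system of determinant αδ -
βγ. -/
theorem cubicFamily_inter_surface {α β γ δ : F} (h : α * δ ≠ β * γ) :
    points (cubicFamily α β γ δ) ∩ surface F = ∅ := by
  rw [points_inter_surface_eq_empty_iff]
  intro u hu hm
  obtain ⟨h5, h2, h4⟩ := mem_cubicFamily.1 hm
  simp only [veroneseVec, Matrix.cons_val] at h5 h4 h2
  have h5' : u 2 = 0 := by simpa using h5
  rw [h5', mul_zero] at h2 h4
  have e0 : (α * δ - β * γ) * u 0 ^ 2 = 0 := by linear_combination β * h4 - δ * h2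
  have e1 : (α * δ - β * γ) * u 1 ^ 2 = 0 := by linear_combination γ * h2 - α * h4
  simp [sub_eq_zero, h] at e0 e1
  apply hu
  ext i
  fin_cases i <;> simp [e0, e1, h5']

theorem conicFamily_inter_surface {α β γ δ : F}
    (h : ∀ x y, x * y = α * x ^ 2 + β * y ^ 2 → γ * x ^ 2 + δ * y ^ 2 = 0 → x = 0 ∧ y = 0) :
    points (conicFamily α β γ δ) ∩ surface F = ∅ := by
  rw [points_inter_surface_eq_empty_iff]
  intro u hu hm
  obtain ⟨h5, h2, h4⟩ := mem_conicFamily.1 hm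
  simp only [veroneseVec, Matrix.cons_val] at h5 h4 h2
  have h5' : u 2 = 0 := by simpa using h5
  rw [h5', mul_zero] at h4
  obtain ⟨e0, e1⟩ := h _ _ h2 h4.symm
  apply hu
  ext i
  fin_cases i <;> simp [e0, e1, h5']

end Families

/-! ### Counting rank-two points of the normal forms. -/

section Counts

variable {F : Type*} [Field F]

/-- The form x² + xy + ey² is anisotropic: a zero with y ≠ 0 would give t² + t = e for t = x/y. -/
theorem eq_zero_of_artinSchreier [CharP F 2] {e x y : F} (he : ∀ t, t ^ 2 + t ≠ e)
    (h : x * y = 1 * x ^ 2 + e * y ^ 2) : x = 0 ∧ y = 0 := by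
  have hy : y = 0 := by
    by_contra hy
    apply he (x / y)
    have h3 : (2 : F) = 0 := CharTwo.two_eq_zero
    field_simp
    linear_combination - h + (x * y - y ^ 2 * e) * h3
  subst hy
  exact ⟨by simpa using h.symm, rfl⟩

theorem ncard_range_of_injective {β : Type*} {f : Fˣ × F → β} (hf : Function.Injective f) :
    (Set.range f).ncard = Nat.card F * (Nat.card F - 1) := by
  rw [← Set.image_univ, Set.ncard_image_of_injective _ hf, Set.ncard_univ, Nat.card_prod,
    Nat.card_units, mul_comm]

variable [Finite F]

theorem ncard_union_of_ranges {β : Type*} [Finite β] {f g : Fˣ × F → β}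
    (hf : Function.Injective f) (hg : Function.Injective g) (h : ∀ p p', f p ≠ g p') :
    (Set.range f ∪ Set.range g).ncard = 2 * Nat.card F * (Nat.card F - 1) := by
  rw [Set.ncard_union_eq, ncard_range_of_injective hf, ncard_range_of_injective hg]
  · ring
  · rw [Set.disjoint_left]
    rintro _ ⟨p, rfl⟩ ⟨p', hp⟩
    exact h p p' hp.symm

variable [CharP F 2]

/-- The count of singular matrices is pulled back to the parameter space, where it becomes the count
of zeros of an explicit ternary cubic. -/
theorem OD0_range {f : (F × F × F) →ₗ[F] (Fin 6 → F)} (hf : Function.Injective f)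
    (hs : points (LinearMap.range f) ∩ surface F = ∅) {a b : ℕ}
    (ha : (points (LinearMap.range f ⊓ zeroDiag F)).ncard = a)
    (hb : {p | f p ∉ zeroDiag F ∧ (symMatrix (f p)).det = 0}.ncard = b * (Nat.card F - 1)) :
    OD0 (points (LinearMap.range f)) =
      ![0, a, b, Nat.card F ^ 2 + Nat.card F + 1 - a - b] := by
  refine OD0_points (finrank_range_of_injective hf) hs ha ?_
  rw [← hb, ← Set.ncard_image_of_injective _ hf]
  congr 1
  ext y
  constructor
  · rintro ⟨⟨p, rfl⟩, h⟩
    exact ⟨p, h, rfl⟩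
  · rintro ⟨p, h, rfl⟩
    exact ⟨⟨p, rfl⟩, h⟩

theorem OD0_cubicFamily {α β γ δ : F} (h : α * δ ≠ β * γ) {b : ℕ}
    (hb : {p : F × F × F | ¬ (p.1 = 0 ∧ p.2.1 = 0) ∧
      p.1 * (γ * p.1 + δ * p.2.1) ^ 2 + p.2.1 * (α * p.1 + β * p.2.1) ^ 2 = 0}.ncard =
        b * (Nat.card F - 1)) :
    OD0 (points (cubicFamily α β γ δ)) = ![0, 1, b, Nat.card F ^ 2 + Nat.card F - b] := by
  have := OD0_range (cubicParam_injective α β γ δ) (cubicFamily_inter_surface h)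
    (a := 1) (b := b) (ncard_points_eq_one_iff.2 (finrank_cubicFamily_inf_zeroDiag α β γ δ))
    (by rw [← hb]; congr 1; ext p; simp [det_symMatrix, mem_zeroDiag, cubicParam])
  simpa [cubicFamily] using this

theorem OD0_conicFamily {α β γ δ : F}
    (h : ∀ x y, x * y = α * x ^ 2 + β * y ^ 2 → γ * x ^ 2 + δ * y ^ 2 = 0 → x = 0 ∧ y = 0)
    {b : ℕ} (hb : {p : F × F × F | ¬ (p.1 = 0 ∧ p.2.1 = 0) ∧
      p.1 * (γ * p.1 + δ * p.2.1) ^ 2 + p.2.1 * p.2.2 ^ 2 = 0}.ncard = b * (Nat.card F - 1)) :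
    OD0 (points (conicFamily α β γ δ)) = ![0, 1, b, Nat.card F ^ 2 + Nat.card F - b] := by
  have := OD0_range (conicParam_injective α β γ δ) (conicFamily_inter_surface h)
    (a := 1) (b := b) (ncard_points_eq_one_iff.2 (finrank_conicFamily_inf_zeroDiag α β γ δ))
    (by rw [← hb]; congr 1; ext p; simp [det_symMatrix, mem_zeroDiag, conicParam])
  simpa [conicFamily] using this

theorem OD0_lineFamily {a b e c : F} (h : c ^ 2 ≠ a * e) (h' : ¬ (a = 0 ∧ b = 0 ∧ e = 0)) {n : ℕ}
    (hb : {p : F × F × F | p.1 ≠ 0 ∧ p.1 * a * (p.1 * b) * (p.1 * e) + p.1 * a * p.2.2 ^ 2 +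
      p.1 * b * (p.1 * c) ^ 2 + p.1 * e * p.2.1 ^ 2 = 0}.ncard = n * (Nat.card F - 1)) :
    OD0 (points (lineFamily a b e c)) =
      ![0, Nat.card F + 1, n, Nat.card F ^ 2 - n] := by
  have := OD0_range (lineParam_injective (fun H => h' ⟨H.1, H.2.1, H.2.2.1⟩))
    (lineFamily_inter_surface h) (a := Nat.card F + 1) (b := n) ?_ ?_
  · have e : Nat.card F ^ 2 + Nat.card F + 1 - (Nat.card F + 1) - n = Nat.card F ^ 2 - n := by
      omega
    rwa [e] at this
  · change (points (lineFamily a b e c ⊓ zeroDiag F)).ncard = _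
    rw [lineFamily_inf_zeroDiag h', ncard_points_of_finrank_eq_two finrank_baseLine]
  · rw [← hb]
    congr 1
    ext p
    simp only [Set.mem_ofPred_eq, det_symMatrix, mem_zeroDiag, lineParam]
    refine and_congr ?_ (by simp)
    simp
    tauto

theorem OD0_cubicFamily_of_no_root {α β γ δ : F} (h : α * δ ≠ β * γ)
    (hr : ∀ x y, x * (γ * x ^ 2 + δ * y ^ 2) + y * (α * x ^ 2 + β * y ^ 2) = 0 →
      x = 0 ∧ y = 0) :
    OD0 (points (cubicFamily α β γ δ)) = ![0, 1, 0, Nat.card F ^ 2 + Nat.card F] := by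
  refine OD0_cubicFamily h (b := 0) ?_
  rw [zero_mul, Set.ncard_eq_zero (Set.toFinite _), Set.eq_empty_iff_forall_notMem]
  rintro ⟨x, y, z⟩ ⟨h1, h2⟩
  apply h1
  -- In terms of square roots of the two diagonal parameters, the determinant is the square of the
  -- binary cubic form.
  obtain ⟨x, rfl⟩ := exists_sq_eq x
  obtain ⟨y, rfl⟩ := exists_sq_eq y
  have h3 : (x * (γ * x ^ 2 + δ * y ^ 2) + y * (α * x ^ 2 + β * y ^ 2)) ^ 2 = 0 := by
    rw [CharTwo.add_sq]
    linear_combination h2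
  obtain ⟨h4, h5⟩ := hr x y (by simpa using h3)
  simp [h4, h5]

/-- The binary cubic is x(ex² + xy + y²) with irreducible quadratic factor. Only x = 0 contributes,
with z free. -/
theorem OD0_cubicFamily_one_root {e : F} (he : ∀ t, t ^ 2 + t ≠ e) :
    OD0 (points (cubicFamily 1 0 e 1)) =
      ![0, 1, Nat.card F, Nat.card F ^ 2] := by
  have := OD0_cubicFamily (α := 1) (β := 0) (γ := e) (δ := 1) (by simp) (b := Nat.card F) ?_
  · simpa using this
  have hf : Function.Injective (fun p : Fˣ × F => ((0 : F), (p.1 : F), p.2)) := by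
    rintro ⟨u, z⟩ ⟨u', z'⟩ h
    simpa [Units.ext_iff] using h
  rw [← ncard_range_of_injective hf]
  congr 1
  ext ⟨x, y, z⟩
  constructor
  · rintro ⟨h1, h2⟩
    simp only at h1 h2
    have hx : x = 0 := by
      by_contra hx
      obtain ⟨t, ht⟩ := exists_sq_eq (y / x)
      have hy : y = t ^ 2 * x := by rw [ht]; field_simp
      subst hy
      apply he t
      apply eq_of_sq_eq_sq
      have h3 : x ^ 3 * ((e + t ^ 2) ^ 2 + t ^ 2) = 0 := by linear_combination h2
      have h4 : (e + t ^ 2) ^ 2 + t ^ 2 = 0 := by simpa [hx] using h3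
      rw [CharTwo.add_sq] at h4 ⊢
      have h2 : (2 : F) = 0 := CharTwo.two_eq_zero
      linear_combination h4 - e ^ 2 * h2
    have hy : y ≠ 0 := fun hy => h1 ⟨hx, hy⟩
    exact ⟨(Units.mk0 y hy, z), by simp [hx]⟩
  · rintro ⟨⟨u, w⟩, h⟩
    simp only [Prod.mk.injEq] at h
    obtain ⟨rfl, rfl, rfl⟩ := h
    simp

/-- The determinant is xy(x + y), and each of the three roots contributes q points since z is free.
-/
theorem OD0_cubicFamily_three_roots :
    OD0 (points (cubicFamily (1 : F) 0 0 1)) =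
      ![0, 1, 3 * Nat.card F, Nat.card F ^ 2 + Nat.card F - 3 * Nat.card F] := by
  refine OD0_cubicFamily (by simp) ?_
  have hf1 : Function.Injective (fun p : Fˣ × F => ((0 : F), (p.1 : F), p.2)) := by
    rintro ⟨u, z⟩ ⟨u', z'⟩ h
    simpa [Units.ext_iff] using h
  have hf2 : Function.Injective (fun p : Fˣ × F => ((p.1 : F), (0 : F), p.2)) := by
    rintro ⟨u, z⟩ ⟨u', z'⟩ h
    simpa [Units.ext_iff] using h
  have hf3 : Function.Injective (fun p : Fˣ × F => ((p.1 : F), (p.1 : F), p.2)) := by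
    rintro ⟨u, z⟩ ⟨u', z'⟩ h
    simpa [Units.ext_iff] using h
  have e : 3 * Nat.card F * (Nat.card F - 1) = Nat.card F * (Nat.card F - 1) +
    Nat.card F * (Nat.card F - 1) + Nat.card F * (Nat.card F - 1) := by ring
  rw [e]
  nth_rw 1 [← ncard_range_of_injective hf1, ← ncard_range_of_injective hf2,
    ← ncard_range_of_injective hf3]
  rw [← Set.ncard_union_eq, ← Set.ncard_union_eq]
  · congr 1
    ext ⟨x, y, z⟩
    simp only [Set.mem_ofPred_eq, Set.mem_union, Set.mem_range, Prod.exists, Prod.mk.injEq]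
    constructor
    · rintro ⟨h1, h2⟩
      have h3 : x * y * (x + y) = 0 := by linear_combination h2
      rcases mul_eq_zero.1 h3 with h3 | h3
      · rcases mul_eq_zero.1 h3 with rfl | rfl
        · exact Or.inl (Or.inl ⟨Units.mk0 y (by simpa using h1), z, by simp⟩)
        · exact Or.inl (Or.inr ⟨Units.mk0 x (by simpa using h1), z, by simp⟩)
      · obtain rfl := CharTwo.add_eq_zero.1 h3
        exact Or.inr ⟨Units.mk0 x (by simpa using h1), z, by simp⟩
    · rintro ((⟨u, w, rfl, rfl, rfl⟩ | ⟨u, w, rfl, rfl, rfl⟩) | ⟨u, w, rfl, rfl, rfl⟩)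
      · simp
      · simp
      · refine ⟨by simp, ?_⟩
        have h2 : (2 : F) = 0 := CharTwo.two_eq_zero
        linear_combination (u : F) ^ 3 * h2
  · rw [Set.disjoint_left]
    rintro _ (⟨⟨u, z⟩, rfl⟩ | ⟨⟨u, z⟩, rfl⟩) ⟨⟨u', z'⟩, h⟩ <;> simp at h
  · rw [Set.disjoint_left]
    rintro _ ⟨⟨u, z⟩, rfl⟩ ⟨⟨u', z'⟩, h⟩
    simp at h

/-- The determinant curve is the cuspidal cubic x³ = yz². Its points with y ≠ 0 are (t², 1, t³), and
y = 0 leaves only the nucleus point. -/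
theorem OD0_conicFamily_one :
    OD0 (points (conicFamily (0 : F) 1 1 0)) = ![0, 1, Nat.card F, Nat.card F ^ 2] := by
  have := OD0_conicFamily (α := (0 : F)) (β := 1) (γ := 1) (δ := 0) ?_ (b := Nat.card F) ?_
  · simpa using this
  · intro x y h1 h2
    have hx : x = 0 := by simpa using h2
    subst hx
    exact ⟨rfl, by simpa using h1.symm⟩
  have hf : Function.Injective
      (fun p : Fˣ × F => (p.2 ^ 2 * (p.1 : F), (p.1 : F), p.2 ^ 3 * (p.1 : F))) := by
    rintro ⟨u, z⟩ ⟨u', z'⟩ h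
    simp only [Prod.mk.injEq, ← Units.ext_iff] at h
    obtain ⟨h1, rfl, -⟩ := h
    have := mul_right_cancel₀ u.ne_zero h1
    rw [eq_of_sq_eq_sq this]
  rw [← ncard_range_of_injective hf]
  congr 1
  ext ⟨x, y, z⟩
  constructor
  · rintro ⟨h1, h2⟩
    simp only at h1 h2
    have hy : y ≠ 0 := by
      rintro rfl
      simp at h1 h2
      exact h1 h2
    obtain ⟨t, ht⟩ := exists_sq_eq (x / y)
    have hx : x = t ^ 2 * y := by rw [ht]; field_simp
    refine ⟨(Units.mk0 y hy, t), ?_⟩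
    simp only [Units.val_mk0, Prod.mk.injEq, true_and]
    refine ⟨hx.symm, ?_⟩
    apply eq_of_sq_eq_sq
    apply mul_left_cancel₀ hy
    subst hx
    have h3 : (2 : F) = 0 := CharTwo.two_eq_zero
    linear_combination (- 1) * h2 + t ^ 6 * y ^ 3 * h3
  · rintro ⟨⟨u, w⟩, h⟩
    simp only [Prod.mk.injEq] at h
    obtain ⟨rfl, rfl, rfl⟩ := h
    refine ⟨by simp, ?_⟩
    have h3 : (2 : F) = 0 := CharTwo.two_eq_zero
    linear_combination w ^ 6 * (u : F) ^ 3 * h3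

/-- The determinant is yz²: the line y = 0 without the nucleus point gives q points, and the line z
= 0 gives q further ones with y ≠ 0. -/
theorem OD0_conicFamily_two {e : F} (he : ∀ t, t ^ 2 + t ≠ e) :
    OD0 (points (conicFamily 1 e 0 0)) =
      ![0, 1, 2 * Nat.card F, Nat.card F ^ 2 + Nat.card F - 2 * Nat.card F] := by
  have hf1 : Function.Injective (fun p : Fˣ × F => ((p.1 : F), (0 : F), p.2)) := by
    rintro ⟨u, z⟩ ⟨u', z'⟩ h
    simpa [Units.ext_iff] using h
  have hf2 : Function.Injective (fun p : Fˣ × F => (p.2, (p.1 : F), (0 : F))) := by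
    rintro ⟨u, z⟩ ⟨u', z'⟩ h
    simpa [Units.ext_iff, and_comm] using h
  refine OD0_conicFamily (fun x y h _ => eq_zero_of_artinSchreier he h) ?_
  rw [← ncard_union_of_ranges hf1 hf2 (by rintro ⟨u, z⟩ ⟨u', z'⟩ h; simp at h; exact u'.ne_zero h.2.1.symm)]
  congr 1
  ext ⟨x, y, z⟩
  simp only [Set.mem_ofPred_eq, Set.mem_union, Set.mem_range, Prod.exists, Prod.mk.injEq]
  constructor
  · rintro ⟨h1, h2⟩
    have h3 : y * z ^ 2 = 0 := by linear_combination h2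
    by_cases hy : y = 0
    · subst hy
      exact Or.inl ⟨Units.mk0 x (by simpa using h1), z, by simp⟩
    · have hz : z = 0 := by simpa [hy] using h3
      exact Or.inr ⟨Units.mk0 y hy, x, by simp [hz]⟩
  · rintro (⟨u, w, rfl, rfl, rfl⟩ | ⟨u, w, rfl, rfl, rfl⟩)
    · simp
    · simp

/-- The determinant is y(xy + z²): q points on the line y = 0 away from the nucleus point, and the q
points (t², 1, t) of the conic off that line. -/
theorem OD0_conicFamily_two' :
    OD0 (points (conicFamily (1 : F) 0 0 1)) =
      ![0, 1, 2 * Nat.card F, Nat.card F ^ 2 + Nat.card F - 2 * Nat.card F] := by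
  have hf1 : Function.Injective (fun p : Fˣ × F => ((p.1 : F), (0 : F), p.2)) := by
    rintro ⟨u, z⟩ ⟨u', z'⟩ h
    simpa [Units.ext_iff] using h
  have hf2 : Function.Injective
      (fun p : Fˣ × F => (p.2 ^ 2 * (p.1 : F), (p.1 : F), p.2 * (p.1 : F))) := by
    rintro ⟨u, z⟩ ⟨u', z'⟩ h
    simp only [Prod.mk.injEq, ← Units.ext_iff] at h
    obtain ⟨-, rfl, h1⟩ := h
    rw [mul_right_cancel₀ u.ne_zero h1]
  refine OD0_conicFamily ?_ ?_
  · intro x y h h'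
    have hy : y = 0 := by simpa using h'
    subst hy
    exact ⟨by simpa using h.symm, rfl⟩
  rw [← ncard_union_of_ranges hf1 hf2 (by rintro ⟨u, z⟩ ⟨u', z'⟩ h; simp at h; exact u'.ne_zero h.2.1.symm)]
  congr 1
  ext ⟨x, y, z⟩
  simp only [Set.mem_ofPred_eq, Set.mem_union, Set.mem_range, Prod.exists, Prod.mk.injEq]
  have h3 : (2 : F) = 0 := CharTwo.two_eq_zero
  constructor
  · rintro ⟨h1, h2⟩
    by_cases hy : y = 0
    · subst hy
      exact Or.inl ⟨Units.mk0 x (by simpa using h1), z, by simp⟩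
    · refine Or.inr ⟨Units.mk0 y hy, z / y, ?_⟩
      have h4 : x * y = z ^ 2 := by
        apply mul_left_cancel₀ hy
        linear_combination h2 - y * z ^ 2 * h3
      simp only [Units.val_mk0, true_and]
      constructor
      · field_simp
        linear_combination - h4
      · field_simp
  · rintro (⟨u, w, rfl, rfl, rfl⟩ | ⟨u, w, rfl, rfl, rfl⟩)
    · simp
    · refine ⟨by simp, ?_⟩
      linear_combination w ^ 2 * (u : F) ^ 3 * h3

/-- The determinant is t³, where t = 0 is the nucleus line. -/
theorem OD0_lineFamily_zero :
    OD0 (points (lineFamily (0 : F) 1 0 1)) = ![0, Nat.card F + 1, 0, Nat.card F ^ 2] := by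
  refine OD0_lineFamily (by simp) (by simp) (n := 0) ?_
  rw [zero_mul, Set.ncard_eq_zero (Set.toFinite _), Set.eq_empty_iff_forall_notMem]
  rintro ⟨x, y, z⟩ ⟨h1, h2⟩
  simp at h1 h2
  exact h1 h2

/-- The determinant is ty², so outside the nucleus line singularity means y = 0. -/
theorem OD0_lineFamily_one :
    OD0 (points (lineFamily (1 : F) 0 0 1)) =
      ![0, Nat.card F + 1, Nat.card F, Nat.card F ^ 2 - Nat.card F] := by
  refine OD0_lineFamily (by simp) (by simp) ?_
  have hf : Function.Injective (fun p : Fˣ × F => ((p.1 : F), p.2, (0 : F))) := by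
    rintro ⟨u, z⟩ ⟨u', z'⟩ h
    simpa [Units.ext_iff] using h
  rw [← ncard_range_of_injective hf]
  congr 1
  ext ⟨t, x, y⟩
  simp only [Set.mem_ofPred_eq, Set.mem_range, Prod.exists, Prod.mk.injEq]
  constructor
  · rintro ⟨h1, h2⟩
    have hy : y = 0 := by simpa [h1] using h2
    exact ⟨Units.mk0 t h1, x, by simp [hy]⟩
  · rintro ⟨u, w, rfl, rfl, rfl⟩
    simp

end Counts

/-! ### The image of t ↦ t² + t. -/

section ArtinSchreier

variable {F : Type*} [Field F] [CharP F 2]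

/-- The additive map `t ↦ t² + t`. -/
def artinSchreier (F : Type*) [Field F] [CharP F 2] : F →+ F where
  toFun t := t ^ 2 + t
  map_zero' := by simp
  map_add' a b := by
    rw [CharTwo.add_sq]
    ring

/-- For an endomorphism of a finite group the index of the image is the order of the kernel, here
{0, 1}. -/
theorem index_range_artinSchreier [Finite F] : (artinSchreier F).range.index = 2 := by
  rw [AddSubgroup.index_range]
  have h : ((artinSchreier F).ker : Set F) = {0, 1} := by
    ext t
    change t ^ 2 + t = 0 ↔ t = 0 ∨ t = 1
    have : t ^ 2 + t = t * (t + 1) := by ring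
    rw [this, mul_eq_zero, CharTwo.add_eq_zero]
  change ((artinSchreier F).ker : Set F).ncard = 2
  rw [h, Set.ncard_pair zero_ne_one]

theorem exists_forall_sq_add_self_ne [Finite F] : ∃ e : F, ∀ t, t ^ 2 + t ≠ e := by
  have h : (artinSchreier F).range ≠ ⊤ := by
    intro h
    have := index_range_artinSchreier (F := F)
    rw [h, AddSubgroup.index_top] at this
    omega
  obtain ⟨e, -, he⟩ := SetLike.exists_of_lt (lt_top_iff_ne_top.2 h)
  exact ⟨e, fun t ht => he ⟨t, ht⟩⟩

/-- The non-values form one coset of a subgroup of index two. Hence a single parameter e suffices in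
the normal forms. -/
theorem exists_sq_add_self_eq_add [Finite F] {e e' : F} (he : ∀ t, t ^ 2 + t ≠ e)
    (he' : ∀ t, t ^ 2 + t ≠ e') : ∃ t, t ^ 2 + t = e + e' := by
  have h1 : e ∉ (artinSchreier F).range := by
    rintro ⟨t, ht⟩
    exact he t ht
  have h2 : e' ∉ (artinSchreier F).range := by
    rintro ⟨t, ht⟩
    exact he' t ht
  obtain ⟨t, ht⟩ := (AddSubgroup.add_mem_iff_of_index_two index_range_artinSchreier).2
    (iff_of_false h1 h2)
  exact ⟨t, ht⟩

end ArtinSchreier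

/-! ### Binary cubic forms without roots. -/

section Cubics

open Polynomial

variable {F : Type*} [Field F]

/-- The binary cubic form `γ x³ + α x² y + δ x y² + β y³` has only the trivial zero. -/
def CubicAnisotropic (α β γ δ : F) : Prop :=
  ∀ x y : F, x * (γ * x ^ 2 + δ * y ^ 2) + y * (α * x ^ 2 + β * y ^ 2) = 0 → x = 0 ∧ y = 0

theorem CubicAnisotropic.leading_ne_zero {α β γ δ : F} (h : CubicAnisotropic α β γ δ) :
    γ ≠ 0 := by
  intro hγ
  have := (h 1 0 (by simp [hγ])).1
  exact one_ne_zero this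

section Extension

variable {E : Type*} [Field E] [Algebra F E]

/-- A cubic polynomial without roots is irreducible, so adjoining a root gives an extension of
degree 3, which embeds in E by uniqueness of finite fields. -/
theorem CubicAnisotropic.exists_root [Finite E] (hE : Module.finrank F E = 3) {α β γ δ : F}
    (h : CubicAnisotropic α β γ δ) : ∃ θ : E, algebraMap F E γ * θ ^ 3 + algebraMap F E α * θ ^ 2 +
      algebraMap F E δ * θ + algebraMap F E β = 0 := by
  set P : F[X] := C γ * X ^ 3 + C α * X ^ 2 + C δ * X + C β with hP
  have hdeg : P.natDegree = 3 := natDegree_cubic h.leading_ne_zero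
  have hirr : Irreducible P := by
    refine irreducible_of_degree_le_three_of_not_isRoot ?_ ?_
    · rw [hdeg]
      decide
    · intro x hx
      have hx' : γ * x ^ 3 + α * x ^ 2 + δ * x + β = 0 := by simpa [hP] using hx
      have := (h x 1 (by linear_combination hx')).2
      exact one_ne_zero this
  have := Fact.mk hirr
  have hfin : Module.finrank F (AdjoinRoot P) = 3 := by
    rw [(AdjoinRoot.powerBasis hirr.ne_zero).finrank, AdjoinRoot.powerBasis_dim, hdeg]
  obtain ⟨f⟩ := FiniteField.nonempty_algHom_of_finrank_dvd (F := F) (K := AdjoinRoot P) (L := E)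
    (by rw [hfin, hE])
  refine ⟨f (AdjoinRoot.root P), ?_⟩
  have h0 : aeval (f (AdjoinRoot.root P)) P = 0 := by
    rw [aeval_algHom_apply, AdjoinRoot.aeval_eq, AdjoinRoot.mk_self, map_zero]
  simpa [hP] using h0

theorem natDegree_minpoly_eq_three (hE : Module.finrank F E = 3) {θ : E}
    (hθ : θ ∉ (algebraMap F E).range) : (minpoly F θ).natDegree = 3 := by
  have : Module.Finite F E := Module.finite_of_finrank_pos (by omega)
  have h := minpoly.degree_dvd (Algebra.IsIntegral.isIntegral (R := F) θ)
  rw [hE] at h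
  rcases (Nat.dvd_prime Nat.prime_three).1 h with h | h
  · exact absurd (minpoly.natDegree_eq_one_iff.1 h) hθ
  · exact h

/-- The homogenised minimal polynomial of any element of E outside F works. -/
theorem exists_cubicAnisotropic_of_finrank (hE : Module.finrank F E = 3) :
    ∃ α β γ δ : F, CubicAnisotropic α β γ δ := by
  obtain ⟨θ, hθ⟩ : ∃ θ : E, θ ∉ (algebraMap F E).range := by
    by_contra! h
    have hs : Function.Surjective (Algebra.linearMap F E) := h
    have := LinearMap.finrank_le_finrank_of_injective (f := (LinearEquiv.ofBijective _
      ⟨(algebraMap F E).injective, hs⟩).symm.toLinearMap) (LinearEquiv.injective _)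
    rw [hE, Module.finrank_self] at this
    omega
  have : Module.Finite F E := Module.finite_of_finrank_pos (by omega)
  have hint := Algebra.IsIntegral.isIntegral (R := F) θ
  have hdeg := natDegree_minpoly_eq_three hE hθ
  set P := minpoly F θ with hP
  refine ⟨P.coeff 2, P.coeff 0, P.coeff 3, P.coeff 1, fun x y hxy => ?_⟩
  have h3 : P.coeff 3 = 1 := by rw [← hdeg]; exact minpoly.monic hint
  by_cases hy : y = 0
  · subst hy
    rw [h3] at hxy
    exact ⟨by simpa using hxy, rfl⟩
  · have hroot : P.IsRoot (x / y) := by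
      rw [IsRoot, eval_eq_sum_range, hdeg]
      simp only [Finset.sum_range_succ, Finset.sum_range_zero]
      field_simp
      linear_combination hxy
    have h1 := degree_eq_one_of_irreducible_of_root (minpoly.irreducible hint) hroot
    rw [← hP, degree_eq_natDegree (minpoly.ne_zero hint), hdeg] at h1
    norm_num at h1

theorem quadratic_relation_trivial (hE : Module.finrank F E = 3) {θ : E}
    (hθ : θ ∉ (algebraMap F E).range) {a b c : F} (h : algebraMap F E a * θ ^ 2 +
      algebraMap F E b * θ + algebraMap F E c = 0) : a = 0 ∧ b = 0 ∧ c = 0 := by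
  have hp : C a * X ^ 2 + C b * X + C c = (0 : F[X]) := by
    refine eq_zero_of_dvd_of_natDegree_lt (minpoly.dvd F θ (by simpa using h)) ?_
    rw [natDegree_minpoly_eq_three hE hθ]
    exact lt_of_le_of_lt natDegree_quadratic_le (by omega)
  have hc := fun n => congrArg (fun p => coeff p n) hp
  refine ⟨?_, ?_, ?_⟩
  · simpa [coeff_X, coeff_C] using hc 2
  · simpa [coeff_X, coeff_C] using hc 1
  · simpa [coeff_X, coeff_C] using hc 0

/-- The four elements 1, θ, θ', θθ' are dependent in a three-dimensional space. A relation of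
determinant zero would make θ or θ' satisfy a nontrivial linear equation over F. -/
theorem exists_fractional_linear_relation (hE : Module.finrank F E = 3) {θ θ' : E}
    (hθ : θ ∉ (algebraMap F E).range) (hθ' : θ' ∉ (algebraMap F E).range) :
    ∃ a b c d : F, a * d - b * c ≠ 0 ∧
      algebraMap F E a * θ + algebraMap F E b =
        θ' * (algebraMap F E c * θ + algebraMap F E d) := by
  have : Module.Finite F E := Module.finite_of_finrank_pos (by omega)
  have hdep : ¬ LinearIndependent F ![1, θ, θ', θ * θ'] := by
    intro h
    have := h.fintype_card_le_finrank
    rw [hE, Fintype.card_fin] at this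
    omega
  obtain ⟨g, hg, i, hi⟩ := Fintype.not_linearIndependent_iff.1 hdep
  simp only [Fin.sum_univ_four, Algebra.smul_def, Matrix.cons_val] at hg
  have hlin : ∀ {τ : E}, τ ∉ (algebraMap F E).range → ∀ {a b : F},
      algebraMap F E a * τ + algebraMap F E b = 0 → a = 0 ∧ b = 0 := by
    intro τ hτ a b hab
    exact (quadratic_relation_trivial hE hτ (a := 0) (by simpa using hab)).2
  have hrel : algebraMap F E (g 1) * θ + algebraMap F E (g 0) =
      θ' * (algebraMap F E (-g 3) * θ + algebraMap F E (-g 2)) := by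
    rw [map_neg, map_neg]
    linear_combination hg
  refine ⟨g 1, g 0, - g 3, - g 2, fun hdet => ?_, hrel⟩
  have hdetE : algebraMap F E (g 1) * algebraMap F E (g 2) =
      algebraMap F E (g 0) * algebraMap F E (g 3) := by
    rw [← map_mul, ← map_mul]
    congr 1
    linear_combination - hdet
  rw [map_neg, map_neg] at hrel
  have h0 : g 3 = 0 ∧ g 2 = 0 := by
    by_cases hD : algebraMap F E (g 3) * θ + algebraMap F E (g 2) = 0
    · exact hlin hθ hD
    · have e1 : algebraMap F E (g 3) * θ' + algebraMap F E (g 1) = 0 := by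
        apply mul_left_cancel₀ hD
        rw [mul_zero]
        linear_combination algebraMap F E (g 3) * hrel + hdetE
      have e2 : algebraMap F E (g 2) * θ' + algebraMap F E (g 0) = 0 := by
        apply mul_left_cancel₀ hD
        rw [mul_zero]
        linear_combination algebraMap F E (g 2) * hrel - θ * hdetE
      exact ⟨(hlin hθ' e1).1, (hlin hθ' e2).1⟩
  have h1 : g 1 = 0 ∧ g 0 = 0 := by
    refine hlin hθ ?_
    rw [hrel, h0.1, h0.2]
    simp
  fin_cases i
  · exact hi h1.2
  · exact hi h1.1
  · exact hi h0.2
  · exact hi h0.1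

theorem not_mem_range_of_root {α β γ δ : F} (h : CubicAnisotropic α β γ δ) {θ : E}
    (hθ : algebraMap F E γ * θ ^ 3 + algebraMap F E α * θ ^ 2 +
      algebraMap F E δ * θ + algebraMap F E β = 0) : θ ∉ (algebraMap F E).range := by
  rintro ⟨x, rfl⟩
  have hx : γ * x ^ 3 + α * x ^ 2 + δ * x + β = 0 := by
    apply (algebraMap F E).injective
    simpa using hθ
  exact one_ne_zero (h x 1 (by linear_combination hx)).2

/-- Two anisotropic binary cubic forms differ by a linear substitution and a scalar. -/
theorem CubicAnisotropic.exists_substitution [CharP F 2] [Finite E] (hE : Module.finrank F E = 3)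
    {α β γ δ α' β' γ' δ' : F} (h : CubicAnisotropic α β γ δ)
    (h' : CubicAnisotropic α' β' γ' δ') : ∃ a b c d κ : F, a * d - b * c ≠ 0 ∧ κ ≠ 0 ∧
      a * (γ' * a ^ 2 + δ' * c ^ 2) + c * (α' * a ^ 2 + β' * c ^ 2) = κ * γ ∧
      a * (γ' * b ^ 2 + δ' * d ^ 2) + c * (α' * b ^ 2 + β' * d ^ 2) = κ * δ ∧
      b * (γ' * a ^ 2 + δ' * c ^ 2) + d * (α' * a ^ 2 + β' * c ^ 2) = κ * α ∧
      b * (γ' * b ^ 2 + δ' * d ^ 2) + d * (α' * b ^ 2 + β' * d ^ 2) = κ * β := by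
  obtain ⟨θ, hθ⟩ := h.exists_root hE
  obtain ⟨θ', hθ'⟩ := h'.exists_root hE
  have hm := not_mem_range_of_root h hθ
  obtain ⟨a, b, c, d, hdet, hrel⟩ :=
    exists_fractional_linear_relation hE hm (not_mem_range_of_root h' hθ')
  have hγ := h.leading_ne_zero
  set c3 := a * (γ' * a ^ 2 + δ' * c ^ 2) + c * (α' * a ^ 2 + β' * c ^ 2) with hc3
  set c1 := a * (γ' * b ^ 2 + δ' * d ^ 2) + c * (α' * b ^ 2 + β' * d ^ 2) with hc1
  set c2 := b * (γ' * a ^ 2 + δ' * c ^ 2) + d * (α' * a ^ 2 + β' * c ^ 2) with hc2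
  set c0 := b * (γ' * b ^ 2 + δ' * d ^ 2) + d * (α' * b ^ 2 + β' * d ^ 2) with hc0
  have h2 : (2 : E) = 0 := by
    rw [← map_ofNat (algebraMap F E) 2, CharTwo.two_eq_zero, map_zero]
  have hroot : algebraMap F E c3 * θ ^ 3 + algebraMap F E c2 * θ ^ 2 + algebraMap F E c1 * θ +
      algebraMap F E c0 = 0 := by
    have hN : ∀ x y : E, (x * θ + y) ^ 2 = x ^ 2 * θ ^ 2 + y ^ 2 := fun x y => by
      linear_combination x * θ * y * h2
    -- The second form at (aθ + b, cθ + d) is its value at (θ', 1) times (cθ + d)³, hence zero.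
    -- Expanding with additive squares gives the substituted form at θ.
    have key : (algebraMap F E a * θ + algebraMap F E b) *
        (algebraMap F E γ' * (algebraMap F E a * θ + algebraMap F E b) ^ 2 +
          algebraMap F E δ' * (algebraMap F E c * θ + algebraMap F E d) ^ 2) +
        (algebraMap F E c * θ + algebraMap F E d) *
        (algebraMap F E α' * (algebraMap F E a * θ + algebraMap F E b) ^ 2 +
          algebraMap F E β' * (algebraMap F E c * θ + algebraMap F E d) ^ 2) = 0 := by
      rw [hrel]
      linear_combination (algebraMap F E c * θ + algebraMap F E d) ^ 3 * hθ'
    rw [hN, hN] at key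
    simp only [hc3, hc2, hc1, hc0, map_add, map_mul, map_pow]
    linear_combination key
  -- Both cubics vanish at θ, which has degree 3. Eliminating the leading terms leaves a trivial
  -- quadratic relation, so the cubics are proportional.
  have hquad : algebraMap F E (γ * c2 - c3 * α) * θ ^ 2 + algebraMap F E (γ * c1 - c3 * δ) * θ +
      algebraMap F E (γ * c0 - c3 * β) = 0 := by
    simp only [map_sub, map_mul]
    linear_combination algebraMap F E γ * hroot - algebraMap F E c3 * hθ
  obtain ⟨e2, e1, e0⟩ := quadratic_relation_trivial hE hm hquad
  -- The factor κ is the quotient of the leading coefficients. Here c3 is the second form at (a, c),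
  -- nonzero by anisotropy since (a, c) ≠ 0.
  refine ⟨a, b, c, d, c3 / γ, hdet, ?_, ?_, ?_, ?_, ?_⟩
  · refine div_ne_zero (fun h0 => hdet ?_) hγ
    obtain ⟨rfl, rfl⟩ := h' a c h0
    ring
  · exact (div_mul_cancel₀ c3 hγ).symm
  · field_simp
    linear_combination e1
  · field_simp
    linear_combination e2
  · field_simp
    linear_combination e0

end Extension

variable [Finite F] [CharP F 2]

theorem exists_cubicAnisotropic : ∃ α β γ δ : F, CubicAnisotropic α β γ δ :=
  exists_cubicAnisotropic_of_finrank (FiniteField.finrank_extension F 2 3)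

/-- If αδ = βγ and t² = δ/γ, the form factors as (γx + αy)(x + ty)² and vanishes at (t, 1). -/
theorem CubicAnisotropic.det_ne_zero {α β γ δ : F} (h : CubicAnisotropic α β γ δ) :
    α * δ ≠ β * γ := by
  intro hdet
  have hγ := h.leading_ne_zero
  obtain ⟨t, ht⟩ := exists_sq_eq (δ / γ)
  have h2 : (2 : F) = 0 := CharTwo.two_eq_zero
  have e1 : γ * t ^ 2 = δ := by rw [ht]; field_simp
  have e2 : α * t ^ 2 = β := by
    apply mul_left_cancel₀ hγ
    linear_combination α * e1 + hdet
  refine one_ne_zero (h t 1 ?_).2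
  linear_combination t * e1 + e2 + (t * δ + β) * h2

end Cubics

/-! ### Planes meeting the nucleus plane in a line. -/

section LineClassification

variable {F : Type*} [Field F]

theorem exists_matrix_col {m : Fin 3 → F} (hm : m ≠ 0) :
    ∃ B : Matrix (Fin 3) (Fin 3) F, B.det ≠ 0 ∧ ∀ i, B i 1 = m i := by
  by_cases h1 : m 1 = 0
  · by_cases h0 : m 0 = 0
    · have h2 : m 2 ≠ 0 := by
        intro h2
        apply hm
        ext i
        fin_cases i <;> simp [*]
      refine ⟨!![1, m 0, 0; 0, m 1, 1; 0, m 2, 0], ?_, ?_⟩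
      · simp [Matrix.det_fin_three, h2]
      · intro i
        fin_cases i <;> rfl
    · refine ⟨!![0, m 0, 0; 1, m 1, 0; 0, m 2, 1], ?_, ?_⟩
      · simp [Matrix.det_fin_three, h0]
      · intro i
        fin_cases i <;> rfl
  · refine ⟨!![1, m 0, 0; 0, m 1, 0; 0, m 2, 1], ?_, ?_⟩
    · simp [Matrix.det_fin_three, h1]
    · intro i
      fin_cases i <;> rfl

theorem exists_matrix_row {m : Fin 3 → F} (hm : m ≠ 0) :
    ∃ B : Matrix (Fin 3) (Fin 3) F, B.det ≠ 0 ∧ ∀ i, B 2 i = m i := by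
  obtain ⟨B, hB, h⟩ := exists_matrix_col hm
  refine ⟨Matrix.of ![(fun i => B i 0), (fun i => B i 2), (fun i => B i 1)], ?_, h⟩
  rw [Matrix.det_fin_three] at hB ⊢
  simp only [Matrix.of_apply, Matrix.cons_val]
  contrapose! hB
  linear_combination - hB

theorem apply_eq_sum (f : (Fin 6 → F) →ₗ[F] F) (y : Fin 6 → F) :
    f y = ∑ i, y i * f (Pi.single i 1) := by
  conv_lhs => rw [pi_eq_sum_univ' y]
  rw [map_sum]
  refine Finset.sum_congr rfl fun i _ => ?_
  rw [map_smul, smul_eq_mul]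

theorem finrank_zeroDiag : Module.finrank F (zeroDiag F) = 3 := by
  let f : (F × F × F) →ₗ[F] (Fin 6 → F) :=
    { toFun := fun p => ![0, p.1, p.2.1, 0, p.2.2, 0]
      map_add' := fun p p' => by
        ext i
        fin_cases i <;> simp
      map_smul' := fun s p => by
        ext i
        fin_cases i <;> simp }
  have hf : Function.Injective f := by
    rintro ⟨x, y, z⟩ ⟨x', y', z'⟩ h
    have h1 : x = x' := congrFun h 1
    have h2 : y = y' := congrFun h 2
    have h4 : z = z' := congrFun h 4
    rw [h1, h2, h4]
  have hr : LinearMap.range f = zeroDiag F := by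
    ext y
    rw [mem_zeroDiag]
    constructor
    · rintro ⟨p, rfl⟩
      simp [f]
    · rintro ⟨h0, h3, h5⟩
      refine ⟨(y 1, y 2, y 4), ?_⟩
      ext i
      fin_cases i <;> simp [f, *]
  rw [← hr, finrank_range_of_injective hf]

/-- Modulo `baseLine F` the space W is spanned by one matrix w with nonzero diagonal, and the
entries y₁, y₄ of w are absorbed by the base line. -/
theorem exists_eq_lineFamily {W : Submodule F (Fin 6 → F)} (hW : Module.finrank F W = 3)
    (hZ : W ⊓ zeroDiag F = baseLine F) :
    ∃ a b e c, ¬ (a = 0 ∧ b = 0 ∧ e = 0) ∧ W = lineFamily a b e c := by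
  obtain ⟨w, hw, hwZ⟩ : ∃ w ∈ W, w ∉ zeroDiag F := by
    by_contra! h
    have h' : W ⊓ zeroDiag F = W := inf_eq_left.2 h
    rw [hZ] at h'
    rw [← h', finrank_baseLine] at hW
    omega
  refine ⟨w 0, w 3, w 5, w 2, hwZ, ?_⟩
  have hle : lineFamily (w 0) (w 3) (w 5) (w 2) ≤ W := by
    intro y hy
    obtain ⟨t, h0, h3, h5, h2⟩ := mem_lineFamily.1 hy
    have hb : y - t • w ∈ baseLine F := by
      rw [mem_baseLine]
      simp [h0, h3, h5, h2]
    rw [← hZ] at hb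
    have := W.add_mem hb.1 (W.smul_mem t hw)
    simpa using this
  refine (Submodule.eq_of_le_of_finrank_eq hle ?_).symm
  rw [hW, finrank_lineFamily]
  exact fun H => hwZ ⟨H.1, H.2.1, H.2.2.1⟩

theorem isCongruent_lineFamily_swap {a b e c : F} (h : ¬ (a = 0 ∧ b = 0 ∧ e = 0)) :
    IsCongruent (lineFamily a b e c) (lineFamily e b a c) := by
  refine isCongruent_of_forall_mem !![0, 0, 1; 0, 1, 0; 1, 0, 0] ?_ ?_ ?_
  · simp [Matrix.det_fin_three]
  · intro y hy
    obtain ⟨t, h0, h3, h5, h2⟩ := mem_lineFamily.1 hy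
    rw [mem_lineFamily]
    refine ⟨t, ?_⟩
    rw [symLift_apply_zero, symLift_apply_three, symLift_apply_five, symLift_apply_two]
    simp [h0, h3, h5, h2]
  · rw [finrank_lineFamily fun H => h ⟨H.1, H.2.1, H.2.2.1⟩,
      finrank_lineFamily fun H => h ⟨H.2.2.1, H.2.1, H.1⟩]

variable [CharP F 2]

/-- View zero-diagonal matrices as bivectors. A functional on them is the wedge product with some
vector m, so U consists of the bivectors divisible by m. The base line consists of those divisible
by e₁, and a matrix B with middle column m carries e₁ to m. -/
theorem isCongruent_baseLine {U : Submodule F (Fin 6 → F)} (hU : U ≤ zeroDiag F)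
    (hr : Module.finrank F U = 2) : IsCongruent (baseLine F) U := by
  obtain ⟨z, hz, hzU⟩ : ∃ z ∈ zeroDiag F, z ∉ U := by
    by_contra! h
    rw [le_antisymm hU h, finrank_zeroDiag] at hr
    omega
  obtain ⟨f, hfz, hf⟩ := Submodule.exists_le_ker_of_notMem hzU
  have hUeq : U = zeroDiag F ⊓ LinearMap.ker f := by
    refine Submodule.eq_of_le_of_finrank_le (le_inf hU hf) ?_
    have hlt : zeroDiag F ⊓ LinearMap.ker f < zeroDiag F :=
      lt_of_le_of_ne inf_le_left fun h => hfz (h.ge hz).2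
    have := Submodule.finrank_lt_finrank_of_lt hlt
    rw [finrank_zeroDiag] at this
    omega
  set m : Fin 3 → F := ![f (Pi.single 4 1), f (Pi.single 2 1), f (Pi.single 1 1)] with hm
  have hfm : ∀ y ∈ zeroDiag F, f y = m 0 * y 4 + m 1 * y 2 + m 2 * y 1 := by
    rintro y ⟨h0, h3, h5⟩
    rw [apply_eq_sum, Fin.sum_univ_six, h0, h3, h5, hm]
    simp only [Matrix.cons_val]
    ring
  have hm0 : m ≠ 0 := by
    intro h
    apply hfz
    rw [hfm z hz, h]
    simp
  obtain ⟨B, hB, hBm⟩ := exists_matrix_col hm0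
  refine isCongruent_of_forall_mem B hB ?_ (by rw [finrank_baseLine, hr])
  intro y hy
  obtain ⟨h0, h3, h5, h2⟩ := mem_baseLine.1 hy
  have hyZ : symLift B y ∈ zeroDiag F := symLift_mem_zeroDiag B ⟨h0, h3, h5⟩
  rw [hUeq]
  refine ⟨hyZ, ?_⟩
  change f (symLift B y) = 0
  rw [hfm _ hyZ, symLift_apply_four, symLift_apply_two, symLift_apply_one, h0, h3, h5, h2,
    ← hBm, ← hBm, ← hBm]
  have h2 : (2 : F) = 0 := CharTwo.two_eq_zero
  linear_combination ((B 0 1 * B 2 1 * B 1 0 + B 0 1 * B 1 1 * B 2 0 + B 1 1 * B 2 1 * B 0 0) * y 1 +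
    (B 0 1 * B 1 1 * B 2 2 + B 0 1 * B 2 1 * B 1 2 + B 1 1 * B 2 1 * B 0 2) * y 4) * h2

variable [Finite F]

/-- If c² = ae, the square roots of a, b, e are the coordinates of a surface point in the family
with t = 1, since y₁ and y₄ are free. -/
theorem sq_ne_of_lineFamily {a b e c : F} (h : ¬ (a = 0 ∧ b = 0 ∧ e = 0))
    (hs : points (lineFamily a b e c) ∩ surface F = ∅) : c ^ 2 ≠ a * e := by
  intro hc
  obtain ⟨a, rfl⟩ := exists_sq_eq a
  obtain ⟨b, rfl⟩ := exists_sq_eq b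
  obtain ⟨e, rfl⟩ := exists_sq_eq e
  have hc' : c = a * e := eq_of_sq_eq_sq (by rw [hc, mul_pow])
  refine points_inter_surface_eq_empty_iff.1 hs ![a, b, e] ?_ ?_
  · intro h0
    apply h
    have := fun i => congrFun h0 i
    exact ⟨by simpa using this 0, by simpa using this 1, by simpa using this 2⟩
  · rw [mem_lineFamily]
    exact ⟨1, by simp [veroneseVec, hc']⟩

/-- With a as pivot, s clears b, r clears e, and ρ rescales the corner ra + c to a. The corner is
nonzero because its square is a(ra·r) + c² = ae + c². -/
theorem isCongruent_lineFamily_one {a b e c : F} (ha : a ≠ 0) (hc : c ^ 2 ≠ a * e) :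
    IsCongruent (lineFamily a b e c) (lineFamily 1 0 0 1) := by
  obtain ⟨s, hs⟩ := exists_sq_eq (b / a)
  obtain ⟨r, hr⟩ := exists_sq_eq (e / a)
  have h2 : (2 : F) = 0 := CharTwo.two_eq_zero
  have hs' : s ^ 2 * a = b := by rw [hs]; field_simp
  have hr' : r ^ 2 * a = e := by rw [hr]; field_simp
  have hd : r * a + c ≠ 0 := by
    intro h0
    apply hc
    linear_combination (r * a + c) * h0 - (r * a * c + a * e) * h2 - a * hr'
  set ρ := a / (r * a + c) with hρ
  have hρ' : ρ * (r * a + c) = a := div_mul_cancel₀ a hd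
  refine isCongruent_of_forall_mem !![1, 0, 0; s, 1, 0; ρ * r, 0, ρ] ?_ ?_ ?_
  · have : ρ ≠ 0 := div_ne_zero ha hd
    simp [Matrix.det_fin_three, this]
  · intro y hy
    obtain ⟨t, h0, h3, h5, h2'⟩ := mem_lineFamily.1 hy
    rw [mem_lineFamily]
    refine ⟨t * a, ?_⟩
    rw [symLift_apply_zero, symLift_apply_three, symLift_apply_five, symLift_apply_two]
    simp only [Matrix.of_apply, Matrix.cons_val', Matrix.cons_val_zero, Matrix.cons_val_one,
      Matrix.cons_val, h0, h3, h5, h2']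
    refine ⟨by ring, ?_, ?_, ?_⟩
    · linear_combination t * hs' + (t * b + s * y 1) * h2
    · linear_combination ρ ^ 2 * t * hr' + (ρ ^ 2 * t * e + ρ ^ 2 * r * t * c) * h2
    · linear_combination t * hρ'
  · rw [finrank_lineFamily (by simp [ha]), finrank_lineFamily (by simp)]

theorem isCongruent_lineFamily_zero {b c : F} (hb : b ≠ 0) (hc : c ≠ 0) :
    IsCongruent (lineFamily 0 b 0 c) (lineFamily 0 1 0 1) := by
  obtain ⟨s, hs⟩ := exists_sq_eq (c / b)
  have hs' : s ^ 2 * b = c := by rw [hs]; field_simp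
  refine isCongruent_of_forall_mem !![1, 0, 0; 0, s, 0; 0, 0, 1] ?_ ?_ ?_
  · have : s ≠ 0 := by
      rintro rfl
      apply hc
      rw [← hs']
      ring
    simp [Matrix.det_fin_three, this]
  · intro y hy
    obtain ⟨t, h0, h3, h5, h2⟩ := mem_lineFamily.1 hy
    rw [mem_lineFamily]
    refine ⟨t * c, ?_⟩
    rw [symLift_apply_zero, symLift_apply_three, symLift_apply_five, symLift_apply_two]
    simp [h0, h3, h5, h2]
    linear_combination t * hs'
  · rw [finrank_lineFamily (by simp [hb]), finrank_lineFamily (by simp)]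

/-- Planes disjoint from the surface that meet the nucleus plane in a line. -/
theorem line_classification {W : Submodule F (Fin 6 → F)} (hW : Module.finrank F W = 3)
    (hs : points W ∩ surface F = ∅) (hZ : Module.finrank F ↥(W ⊓ zeroDiag F) = 2) :
    IsCongruent (lineFamily 0 1 0 1) W ∨ IsCongruent (lineFamily 1 0 0 1) W := by
  obtain ⟨A, hA⟩ := (isCongruent_baseLine inf_le_right hZ).symm
  have hc : IsCongruent W (W.map (symLift A.1)) := ⟨A, rfl⟩
  rw [← map_symLift_inf_zeroDiag] at hA
  obtain ⟨a, b, e, c, hne, heq⟩ := exists_eq_lineFamily (hc.finrank_eq ▸ hW) hA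
  rw [heq] at hc
  have hne' := sq_ne_of_lineFamily hne (hc.inter_surface hs)
  by_cases ha : a = 0
  · by_cases he : e = 0
    · subst ha he
      have hb : b ≠ 0 := by simpa using hne
      have hc0 : c ≠ 0 := by simpa using hne'
      exact Or.inl (hc.trans (isCongruent_lineFamily_zero hb hc0)).symm
    · refine Or.inr ((hc.trans (isCongruent_lineFamily_swap hne)).trans
        (isCongruent_lineFamily_one he ?_)).symm
      rwa [mul_comm]
  · exact Or.inr (hc.trans (isCongruent_lineFamily_one ha hne')).symm

end LineClassification

/-! ### Reduction of planes meeting the nucleus plane in a point. -/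

section PointClassification

variable {F : Type*} [Field F]

/-- The diagonal of a symmetric matrix. -/
def diagMap (F : Type*) [Field F] : (Fin 6 → F) →ₗ[F] (F × F × F) where
  toFun y := (y 0, y 3, y 5)
  map_add' _ _ := rfl
  map_smul' _ _ := rfl

theorem ker_diagMap : LinearMap.ker (diagMap F) = zeroDiag F := by
  ext y
  simp [diagMap, mem_zeroDiag]

theorem finrank_map_add_finrank_inf_ker {V : Type*} [AddCommGroup V] [Module F V]
    (f : (Fin 6 → F) →ₗ[F] V) (W : Submodule F (Fin 6 → F)) :
    Module.finrank F (W.map f) + Module.finrank F ↥(W ⊓ LinearMap.ker f) =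
      Module.finrank F W := by
  have h := (f.domRestrict W).finrank_range_add_finrank_ker
  rw [LinearMap.range_domRestrict] at h
  rw [← h]
  congr 1
  rw [LinearMap.ker_domRestrict, ← Submodule.finrank_map_subtype_eq W,
    Submodule.map_comap_subtype]

/-- The diagonal map has a kernel of dimension one on W, so its image has dimension two and lies in
a hyperplane. -/
theorem exists_diag_relation {W : Submodule F (Fin 6 → F)} (hW : Module.finrank F W = 3)
    (hZ : Module.finrank F ↥(W ⊓ zeroDiag F) = 1) :
    ∃ m : Fin 3 → F, m ≠ 0 ∧ ∀ y ∈ W, m 0 * y 0 + m 1 * y 3 + m 2 * y 5 = 0 := by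
  have h := finrank_map_add_finrank_inf_ker (diagMap F) W
  rw [ker_diagMap, hW, hZ] at h
  have hlt : W.map (diagMap F) < ⊤ := by
    refine lt_top_iff_ne_top.2 fun htop => ?_
    rw [htop, finrank_top] at h
    simp at h
  obtain ⟨f, hf0, hf⟩ := Submodule.exists_le_ker_of_lt_top _ hlt
  have hfe : ∀ x y z : F, f (x, y, z) = f (1, 0, 0) * x + f (0, 1, 0) * y + f (0, 0, 1) * z := by
    intro x y z
    have : ((x, y, z) : F × F × F) =
        x • ((1, 0, 0) : F × F × F) + y • ((0, 1, 0) : F × F × F) + z • ((0, 0, 1) : F × F × F) := by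
      simp
    conv_lhs => rw [this]
    simp only [map_add, map_smul, smul_eq_mul]
    ring
  refine ⟨![f (1, 0, 0), f (0, 1, 0), f (0, 0, 1)], fun h0 => hf0 ?_, fun y hy => ?_⟩
  · have h' := fun i => congrFun h0 i
    have e0 : f (1, 0, 0) = 0 := h' 0
    have e1 : f (0, 1, 0) = 0 := h' 1
    have e2 : f (0, 0, 1) = 0 := h' 2
    refine LinearMap.ext fun ⟨x, y, z⟩ => ?_
    rw [hfe, e0, e1, e2]
    simp
  · have := hf (Submodule.mem_map_of_mem (f := diagMap F) hy)
    change f (y 0, y 3, y 5) = 0 at this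
    rwa [hfe] at this

/-- A plane inside the hyperplane `y₅ = 0` whose intersection with the matrices of zero diagonal
is a point is the graph of a linear map over the coordinates `y₀, y₃`. -/
theorem exists_graph_vectors {W : Submodule F (Fin 6 → F)} (hW : Module.finrank F W = 3)
    (hZ : Module.finrank F ↥(W ⊓ zeroDiag F) = 1) (h5 : ∀ y ∈ W, y 5 = 0) :
    ∃ w ∈ W, ∃ w' ∈ W, w 0 = 1 ∧ w 3 = 0 ∧ w' 0 = 0 ∧ w' 3 = 1 := by
  let g : (Fin 6 → F) →ₗ[F] (F × F) :=
    { toFun := fun y => (y 0, y 3)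
      map_add' := fun _ _ => rfl
      map_smul' := fun _ _ => rfl }
  have hk : W ⊓ LinearMap.ker g = W ⊓ zeroDiag F := by
    ext y
    simp only [Submodule.mem_inf, LinearMap.mem_ker, mem_zeroDiag]
    refine and_congr_right fun hy => ?_
    simp [g, h5 y hy]
  have h := finrank_map_add_finrank_inf_ker g W
  rw [hk, hW, hZ] at h
  have htop : W.map g = ⊤ := by
    apply Submodule.eq_top_of_finrank_eq
    have : Module.finrank F (F × F) = 2 := by simp
    omega
  obtain ⟨w, hw, hw'⟩ : ((1, 0) : F × F) ∈ W.map g := htop ▸ Submodule.mem_top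
  obtain ⟨v, hv, hv'⟩ : ((0, 1) : F × F) ∈ W.map g := htop ▸ Submodule.mem_top
  simp only [g, LinearMap.coe_mk, AddHom.coe_mk, Prod.mk.injEq] at hw' hv'
  exact ⟨w, hw, v, hv, hw'.1, hw'.2, hv'.1, hv'.2⟩

theorem eq_cubicFamily {W : Submodule F (Fin 6 → F)} (hW : Module.finrank F W = 3)
    (hZ : Module.finrank F ↥(W ⊓ zeroDiag F) = 1) (h5 : ∀ y ∈ W, y 5 = 0)
    (hN : ∀ y ∈ W ⊓ zeroDiag F, y 2 = 0 ∧ y 4 = 0) : ∃ α β γ δ, W = cubicFamily α β γ δ := by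
  obtain ⟨w, hw, w', hw', e1, e2, e3, e4⟩ := exists_graph_vectors hW hZ h5
  refine ⟨w 2, w' 2, w 4, w' 4, Submodule.eq_of_le_of_finrank_eq ?_ ?_⟩
  · intro y hy
    have hm : y - y 0 • w - y 3 • w' ∈ W ⊓ zeroDiag F := by
      refine ⟨W.sub_mem (W.sub_mem hy (W.smul_mem _ hw)) (W.smul_mem _ hw'), ?_⟩
      change _ ∧ _ ∧ _
      simp [e1, e2, e3, e4, h5 _ hy, h5 _ hw, h5 _ hw']
    obtain ⟨h2, h4⟩ := hN _ hm
    simp only [Pi.sub_apply, Pi.smul_apply, smul_eq_mul] at h2 h4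
    exact mem_cubicFamily.2 ⟨h5 y hy, by linear_combination h2, by linear_combination h4⟩
  · rw [hW, finrank_cubicFamily]

theorem eq_conicFamily {W : Submodule F (Fin 6 → F)} (hW : Module.finrank F W = 3)
    (hZ : Module.finrank F ↥(W ⊓ zeroDiag F) = 1) (h5 : ∀ y ∈ W, y 5 = 0)
    (hN : ∀ y ∈ W ⊓ zeroDiag F, y 1 = 0 ∧ y 4 = 0) : ∃ α β γ δ, W = conicFamily α β γ δ := by
  obtain ⟨w, hw, w', hw', e1, e2, e3, e4⟩ := exists_graph_vectors hW hZ h5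
  refine ⟨w 1, w' 1, w 4, w' 4, Submodule.eq_of_le_of_finrank_eq ?_ ?_⟩
  · intro y hy
    have hm : y - y 0 • w - y 3 • w' ∈ W ⊓ zeroDiag F := by
      refine ⟨W.sub_mem (W.sub_mem hy (W.smul_mem _ hw)) (W.smul_mem _ hw'), ?_⟩
      change _ ∧ _ ∧ _
      simp [e1, e2, e3, e4, h5 _ hy, h5 _ hw, h5 _ hw']
    obtain ⟨h2, h4⟩ := hN _ hm
    simp only [Pi.sub_apply, Pi.smul_apply, smul_eq_mul] at h2 h4
    exact mem_conicFamily.2 ⟨h5 y hy, by linear_combination h2, by linear_combination h4⟩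
  · rw [hW, finrank_conicFamily]

variable [CharP F 2]

/-- The alternating matrix n kills (n₄, n₂, n₁). Making the middle row of A a multiple of that
vector clears the entries in the middle row; the last row (0, 0, 1) preserves the condition y₅ = 0.
-/
theorem exists_matrix_clearing {n : Fin 6 → F} (hn : ¬ (n 2 = 0 ∧ n 4 = 0)) :
    ∃ A : Matrix (Fin 3) (Fin 3) F, A.det ≠ 0 ∧ A 2 = ![0, 0, 1] ∧
      (n ∈ zeroDiag F → symLift A n 1 = 0 ∧ symLift A n 4 = 0) := by
  have h2 : (2 : F) = 0 := CharTwo.two_eq_zero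
  by_cases hn2 : n 2 = 0
  · have hn4 : n 4 ≠ 0 := fun h => hn ⟨hn2, h⟩
    refine ⟨!![0, 1, 0; 1, 0, n 1 / n 4; 0, 0, 1], ?_, rfl, ?_⟩
    · simp [Matrix.det_fin_three]
    · rintro ⟨h0, h3, h5⟩
      rw [symLift_apply_one, symLift_apply_four]
      simp only [Matrix.of_apply, Matrix.cons_val', Matrix.cons_val_zero, Matrix.cons_val_one,
        Matrix.cons_val, h0, h3, h5, hn2]
      refine ⟨?_, by ring⟩
      field_simp
      linear_combination n 4 * n 1 * h2
  · refine ⟨!![1, 0, 0; n 4 / n 2, 1, n 1 / n 2; 0, 0, 1], ?_, rfl, ?_⟩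
    · simp [Matrix.det_fin_three]
    · rintro ⟨h0, h3, h5⟩
      rw [symLift_apply_one, symLift_apply_four]
      simp only [Matrix.of_apply, Matrix.cons_val', Matrix.cons_val_zero, Matrix.cons_val_one,
        Matrix.cons_val, h0, h3, h5]
      constructor
      · field_simp
        linear_combination n 2 * n 1 * h2
      · field_simp
        linear_combination n 2 * n 4 * h2

variable [Finite F]

theorem isCongruent_family {W : Submodule F (Fin 6 → F)} (hW : Module.finrank F W = 3)
    (hZ : Module.finrank F ↥(W ⊓ zeroDiag F) = 1) :
    ∃ α β γ δ, IsCongruent W (cubicFamily α β γ δ) ∨ IsCongruent W (conicFamily α β γ δ) := by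
  have h2 : (2 : F) = 0 := CharTwo.two_eq_zero
  obtain ⟨m, hm0, hm⟩ := exists_diag_relation hW hZ
  -- A last row k produces the new entry y₅ = k₀²y₀ + k₁²y₃ + k₂²y₅, so the relation m is turned
  -- into y₅ = 0 by its square roots.
  choose k hk using fun i => exists_sq_eq (m i)
  have hk0 : k ≠ 0 := by
    rintro rfl
    apply hm0
    ext i
    rw [← hk i]
    simp
  obtain ⟨A, hA, hAk⟩ := exists_matrix_row hk0
  set W₁ := W.map (symLift A) with hW₁
  have hc₁ : IsCongruent W W₁ := ⟨Matrix.GeneralLinearGroup.mkOfDetNeZero A hA, rfl⟩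
  have h₁ : ∀ y ∈ W₁, y 5 = 0 := by
    rintro _ ⟨y, hy, rfl⟩
    rw [symLift_apply_five, hAk, hAk, hAk, hk, hk, hk]
    linear_combination hm y hy +
      (k 0 * k 1 * y 1 + k 0 * k 2 * y 2 + k 1 * k 2 * y 4) * h2
  have hr₁ : Module.finrank F W₁ = 3 := hc₁.finrank_eq ▸ hW
  have hz₁ : Module.finrank F ↥(W₁ ⊓ zeroDiag F) = 1 := hc₁.inf_zeroDiag.finrank_eq ▸ hZ
  -- The question is whether the nucleus matrix kills e₂.
  by_cases hN : ∀ y ∈ W₁ ⊓ zeroDiag F, y 2 = 0 ∧ y 4 = 0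
  · obtain ⟨α, β, γ, δ, h⟩ := eq_cubicFamily hr₁ hz₁ h₁ hN
    exact ⟨α, β, γ, δ, Or.inl (h ▸ hc₁)⟩
  · push Not at hN
    obtain ⟨n, hnm, hn⟩ := hN
    obtain ⟨B, hB, hB2, hBn⟩ := exists_matrix_clearing (n := n) (fun h => hn h.1 h.2)
    have hc₂ : IsCongruent W₁ (W₁.map (symLift B)) :=
      ⟨Matrix.GeneralLinearGroup.mkOfDetNeZero B hB, rfl⟩
    have hinf : W₁.map (symLift B) ⊓ zeroDiag F = (W₁ ⊓ zeroDiag F).map (symLift B) :=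
      map_symLift_inf_zeroDiag (Matrix.GeneralLinearGroup.mkOfDetNeZero B hB) W₁
    have hn0 : (⟨n, hnm⟩ : ↥(W₁ ⊓ zeroDiag F)) ≠ 0 := by
      intro h0
      have h0' : n = 0 := congrArg Subtype.val h0
      exact hn (by rw [h0']; rfl) (by rw [h0']; rfl)
    obtain ⟨α, β, γ, δ, h⟩ := eq_conicFamily (hc₂.finrank_eq ▸ hr₁)
      (hc₂.inf_zeroDiag.finrank_eq ▸ hz₁)
      (by
        rintro _ ⟨y, hy, rfl⟩
        rw [symLift_apply_five, hB2]
        simp [h₁ y hy])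
      (by
        rw [hinf]
        rintro _ ⟨y, hy, rfl⟩
        obtain ⟨c, hc⟩ := (finrank_eq_one_iff_of_nonzero' _ hn0).1 hz₁ ⟨y, hy⟩
        have hy' : y = c • n := (congrArg Subtype.val hc).symm
        obtain ⟨e1, e4⟩ := hBn hnm.2
        rw [hy', map_smul]
        simp [e1, e4])
    exact ⟨α, β, γ, δ, Or.inr (h ▸ hc₁.trans hc₂)⟩

end PointClassification

/-! ### Normal forms of the cubic family. -/

section CubicNormalForms

variable {F : Type*} [Field F]

/-- A linear substitution on the first two coordinates acts on the cubic family. -/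
theorem isCongruent_cubicFamily [CharP F 2] {α β γ δ α' β' γ' δ' : F} (a b c d s : F)
    (hdet : a * d - b * c ≠ 0) (hs : s ≠ 0)
    (h00 : α' * a ^ 2 + β' * c ^ 2 = s * (a * α + b * γ))
    (h01 : α' * b ^ 2 + β' * d ^ 2 = s * (a * β + b * δ))
    (h10 : γ' * a ^ 2 + δ' * c ^ 2 = s * (c * α + d * γ))
    (h11 : γ' * b ^ 2 + δ' * d ^ 2 = s * (c * β + d * δ)) :
    IsCongruent (cubicFamily α β γ δ) (cubicFamily α' β' γ' δ') := by
  have h2 : (2 : F) = 0 := CharTwo.two_eq_zero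
  refine isCongruent_of_forall_mem !![a, b, 0; c, d, 0; 0, 0, s] ?_ ?_ ?_
  · have : (a * d - b * c) * s ≠ 0 := mul_ne_zero hdet hs
    simp only [Matrix.det_fin_three, Matrix.of_apply, Matrix.cons_val', Matrix.cons_val_zero,
      Matrix.cons_val_one, Matrix.cons_val]
    contrapose! this
    linear_combination this
  · intro y hy
    obtain ⟨e5, e2, e4⟩ := mem_cubicFamily.1 hy
    rw [mem_cubicFamily, symLift_apply_zero, symLift_apply_two, symLift_apply_three, symLift_apply_four, symLift_apply_five]
    simp only [Matrix.of_apply, Matrix.cons_val', Matrix.cons_val_zero, Matrix.cons_val_one,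
      Matrix.cons_val, e5, e2, e4]
    refine ⟨by ring, ?_, ?_⟩
    · linear_combination - y 0 * h00 - y 3 * h01 - (α' * a * b * y 1 + β' * c * d * y 1) * h2
    · linear_combination - y 0 * h10 - y 3 * h11 - (γ' * a * b * y 1 + δ' * c * d * y 1) * h2
  · rw [finrank_cubicFamily, finrank_cubicFamily]

variable [CharP F 2] [Finite F]

/-- A nonzero kernel vector of the coefficient matrix, after square roots, gives a surface point
with u₂ = 0. -/
theorem det_ne_of_cubicFamily {α β γ δ : F}
    (hs : points (cubicFamily α β γ δ) ∩ surface F = ∅) : α * δ ≠ β * γ := by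
  intro hdet
  have h2 : (2 : F) = 0 := CharTwo.two_eq_zero
  obtain ⟨x, y, hxy, e1, e2⟩ : ∃ x y : F, ¬ (x = 0 ∧ y = 0) ∧ α * x + β * y = 0 ∧
      γ * x + δ * y = 0 := by
    by_cases h1 : α = 0 ∧ β = 0
    · by_cases h3 : γ = 0 ∧ δ = 0
      · exact ⟨1, 0, by simp, by simp [h1], by simp [h3]⟩
      · exact ⟨δ, γ, fun h => h3 ⟨h.2, h.1⟩, by simp [h1],
          by linear_combination γ * δ * h2⟩
    · exact ⟨β, α, fun h => h1 ⟨h.2, h.1⟩, by linear_combination α * β * h2,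
        by linear_combination hdet + β * γ * h2⟩
  obtain ⟨x, rfl⟩ := exists_sq_eq x
  obtain ⟨y, rfl⟩ := exists_sq_eq y
  refine points_inter_surface_eq_empty_iff.1 hs ![x, y, 0] ?_ ?_
  · intro h0
    have h' := fun i => congrFun h0 i
    have hx : x = 0 := h' 0
    have hy : y = 0 := h' 1
    exact hxy (by simp [hx, hy])
  · rw [mem_cubicFamily]
    simp [veroneseVec, e1, e2]

theorem cubicFamily_classification {e α₀ β₀ γ₀ δ₀ : F} (he : ∀ t, t ^ 2 + t ≠ e)
    (h₀ : CubicAnisotropic α₀ β₀ γ₀ δ₀) {α β γ δ : F}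
    (hs : points (cubicFamily α β γ δ) ∩ surface F = ∅) :
    IsCongruent (cubicFamily α₀ β₀ γ₀ δ₀) (cubicFamily α β γ δ) ∨
      IsCongruent (cubicFamily 1 0 e 1) (cubicFamily α β γ δ) ∨
      IsCongruent (cubicFamily 1 0 0 1) (cubicFamily α β γ δ) := by
  have h2 : (2 : F) = 0 := CharTwo.two_eq_zero
  -- With β = 0 the form is x(γx² + αxy + δy²), and the Artin–Schreier class of δγ/α² decides
  -- whether the quadratic factor splits.
  have hroot : ∀ {α γ δ : F}, points (cubicFamily α 0 γ δ) ∩ surface F = ∅ →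
      IsCongruent (cubicFamily 1 0 e 1) (cubicFamily α 0 γ δ) ∨
      IsCongruent (cubicFamily 1 0 0 1) (cubicFamily α 0 γ δ) := by
    intro α γ δ hs
    have hdet : α * δ ≠ 0 := by simpa using det_ne_of_cubicFamily hs
    have hα : α ≠ 0 := left_ne_zero_of_mul hdet
    have hδ : δ ≠ 0 := right_ne_zero_of_mul hdet
    -- The parameter τ is a shear, which changes δγ/α² by τ² + τ.
    have key : ∀ γ' τ : F, γ' * α ^ 2 = τ ^ 2 * α ^ 2 + τ * α ^ 2 + δ * γ →
        IsCongruent (cubicFamily 1 0 γ' 1) (cubicFamily α 0 γ δ) := by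
      intro γ' τ h
      refine (isCongruent_cubicFamily α 0 (α * τ) δ 1 ?_ one_ne_zero ?_ ?_ ?_ ?_).symm
      · simpa using hdet
      · ring
      · ring
      · linear_combination h + τ ^ 2 * α ^ 2 * h2
      · ring
    by_cases ht : ∃ t, t ^ 2 + t = δ * γ / α ^ 2
    · obtain ⟨t, ht⟩ := ht
      right
      refine key 0 t ?_
      field_simp at ht
      linear_combination (-1) * ht - γ * δ * h2
    · push Not at ht
      left
      obtain ⟨t, ht'⟩ := exists_sq_add_self_eq_add he ht
      refine key e t ?_
      have : t ^ 2 * α ^ 2 + t * α ^ 2 = e * α ^ 2 + δ * γ := by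
        field_simp at ht'
        linear_combination ht'
      linear_combination (-1) * this - γ * δ * h2
  by_cases hβ : β = 0
  · subst hβ
    exact Or.inr (hroot hs)
  by_cases h : CubicAnisotropic α β γ δ
  · left
    obtain ⟨a, b, c, d, κ, hdet, hκ, e1, e2, e3, e4⟩ :=
      CubicAnisotropic.exists_substitution (FiniteField.finrank_extension F 2 3) h h₀
    -- The four substitution relations are a linear system for the transformed coefficient rows;
    -- inverting it divides κ by the determinant.
    refine (isCongruent_cubicFamily a b c d (κ / (a * d - b * c)) hdet (div_ne_zero hκ hdet)
      ?_ ?_ ?_ ?_).symm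
    · rw [div_mul_eq_mul_div, eq_div_iff hdet]
      linear_combination a * e3 + b * e1 -
        (b * a * (γ₀ * a ^ 2 + δ₀ * c ^ 2) +
          b * c * (α₀ * a ^ 2 + β₀ * c ^ 2)) * h2
    · rw [div_mul_eq_mul_div, eq_div_iff hdet]
      linear_combination a * e4 + b * e2 -
        (b * a * (γ₀ * b ^ 2 + δ₀ * d ^ 2) +
          b * c * (α₀ * b ^ 2 + β₀ * d ^ 2)) * h2
    · rw [div_mul_eq_mul_div, eq_div_iff hdet]
      linear_combination c * e3 + d * e1 -
        (b * c * (γ₀ * a ^ 2 + δ₀ * c ^ 2) +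
          d * c * (α₀ * a ^ 2 + β₀ * c ^ 2)) * h2
    · rw [div_mul_eq_mul_div, eq_div_iff hdet]
      linear_combination c * e4 + d * e2 -
        (b * c * (γ₀ * b ^ 2 + δ₀ * d ^ 2) +
          d * c * (α₀ * b ^ 2 + β₀ * d ^ 2)) * h2
  · right
    rw [CubicAnisotropic] at h
    push Not at h
    obtain ⟨x, y, hxy, hne⟩ := h
    have hx : x ≠ 0 := by
      rintro rfl
      have hy := hne rfl
      apply hβ
      have : y ^ 3 * β = 0 := by linear_combination hxy
      simpa [hy] using this
    set t := y / x with ht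
    have hy : y = t * x := by rw [ht]; field_simp
    have hroot' : γ + α * t + δ * t ^ 2 + β * t ^ 3 = 0 := by
      have : x ^ 3 * (γ + α * t + δ * t ^ 2 + β * t ^ 3) = 0 := by
        rw [hy] at hxy
        linear_combination hxy
      simpa [hx] using this
    -- The substitution sends the root (1, t) to (0, 1), which makes the new coefficient of y³ zero.
    have hc : IsCongruent (cubicFamily α β γ δ) (cubicFamily (t * β + δ) 0 β (α + t ^ 2 * β)) := by
      refine isCongruent_cubicFamily t 1 1 0 1 (by simp) one_ne_zero ?_ ?_ ?_ ?_
      · linear_combination (-1) * hroot' + (t ^ 3 * β + δ * t ^ 2) * h2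
      · ring
      · linear_combination t ^ 2 * β * h2
      · ring
    rcases hroot (hc.inter_surface hs) with h | h
    · exact Or.inl (h.trans hc.symm)
    · exact Or.inr (h.trans hc.symm)

end CubicNormalForms

/-! ### Normal forms of the conic family. -/

section ConicNormalForms

variable {F : Type*} [Field F]

/-- Upper triangular matrices act on the conic family. -/
theorem isCongruent_conicFamily [CharP F 2] {α β γ δ α' β' γ' δ' : F} (a b c g h : F)
    (ha : a ≠ 0) (hb : b ≠ 0) (hc : c ≠ 0)
    (e00 : a * b * (α + g * γ) = α' * a ^ 2)
    (e01 : a * b * (β + h + g * δ) = α' * a ^ 2 * h ^ 2 + β' * b ^ 2)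
    (e10 : b * c * γ = γ' * a ^ 2)
    (e11 : b * c * δ = γ' * a ^ 2 * h ^ 2 + δ' * b ^ 2) :
    IsCongruent (conicFamily α β γ δ) (conicFamily α' β' γ' δ') := by
  have h2 : (2 : F) = 0 := CharTwo.two_eq_zero
  refine isCongruent_of_forall_mem !![a, a * h, a * g; 0, b, 0; 0, 0, c] ?_ ?_ ?_
  · simp [Matrix.det_fin_three, ha, hb, hc]
  · intro y hy
    obtain ⟨e5, e1, e4⟩ := mem_conicFamily.1 hy
    rw [mem_conicFamily, symLift_apply_zero, symLift_apply_one, symLift_apply_three, symLift_apply_four, symLift_apply_five, h2]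
    simp only [Matrix.of_apply, Matrix.cons_val', Matrix.cons_val_zero, Matrix.cons_val_one,
      Matrix.cons_val, e5, e1, e4]
    refine ⟨by ring, ?_, ?_⟩
    · linear_combination y 0 * e00 + y 3 * e01
    · linear_combination y 0 * e10 + y 3 * e11
  · rw [finrank_conicFamily, finrank_conicFamily]

theorem conicFamily_isotropic {α β γ δ : F}
    (hs : points (conicFamily α β γ δ) ∩ surface F = ∅) (x y : F)
    (h1 : x * y = α * x ^ 2 + β * y ^ 2) (h2 : γ * x ^ 2 + δ * y ^ 2 = 0) : x = 0 ∧ y = 0 := by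
  by_contra hxy
  refine points_inter_surface_eq_empty_iff.1 hs ![x, y, 0] ?_ ?_
  · intro h0
    exact hxy ⟨congrFun h0 0, congrFun h0 1⟩
  · rw [mem_conicFamily]
    simp [veroneseVec, h1, h2]

/-- If γ ≠ 0, the shears g and h clear α and δ, and disjointness keeps the remaining coefficient b
nonzero. If γ = 0, disjointness forces α ≠ 0. Then δ ≠ 0 lets g clear β, while δ = 0 leaves an
anisotropic form αx² + xy + βy², normalised by Artin–Schreier. -/
theorem conicFamily_classification [CharP F 2] [Finite F] {e : F} (he : ∀ t, t ^ 2 + t ≠ e) {α β γ δ : F}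
    (hs : points (conicFamily α β γ δ) ∩ surface F = ∅) :
    IsCongruent (conicFamily 0 1 1 0) (conicFamily α β γ δ) ∨
      IsCongruent (conicFamily 1 0 0 1) (conicFamily α β γ δ) ∨
      IsCongruent (conicFamily 1 e 0 0) (conicFamily α β γ δ) := by
  have h2 : (2 : F) = 0 := CharTwo.two_eq_zero
  have hiso := conicFamily_isotropic hs
  by_cases hγ : γ = 0
  · subst hγ
    have hα : α ≠ 0 := by
      rintro rfl
      exact one_ne_zero (hiso 1 0 (by ring) (by ring)).1
    by_cases hδ : δ = 0
    · subst hδ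
      right; right
      -- A solution t would make (t/α, 1) isotropic and produce a surface point.
      have hne : ∀ t, t ^ 2 + t ≠ α * β := by
        intro t ht
        refine one_ne_zero (hiso (t / α) 1 ?_ (by ring)).2
        field_simp
        linear_combination (-1) * ht + (t - α * β) * h2
      obtain ⟨t, ht⟩ := exists_sq_add_self_eq_add he hne
      refine (isCongruent_conicFamily α 1 1 0 (t / α) hα one_ne_zero one_ne_zero ?_ ?_ ?_ ?_).symm
      · ring
      · field_simp
        linear_combination (-1) * ht + (t - e) * h2
      · ring
      · ring
    · right; left
      refine (isCongruent_conicFamily α 1 (1 / δ) (β / δ) 0 hα one_ne_zero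
        (one_div_ne_zero hδ) ?_ ?_ ?_ ?_).symm
      · ring
      · field_simp
        linear_combination α * β * h2
      · ring
      · field_simp
        ring
  · left
    obtain ⟨h, hh⟩ := exists_sq_eq (δ / γ)
    have hh' : γ * h ^ 2 = δ := by rw [hh]; field_simp
    have hb : β + h + α * h ^ 2 ≠ 0 := by
      intro h0
      refine one_ne_zero (hiso h 1 ?_ ?_).2
      · linear_combination (-1) * h0 + h * h2
      · linear_combination hh' + δ * h2
    set b := β + h + α * h ^ 2 with hbd
    refine (isCongruent_conicFamily 1 b (1 / (b * γ)) (α / γ) h one_ne_zero hb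
      (one_div_ne_zero (mul_ne_zero hb hγ)) ?_ ?_ ?_ ?_).symm
    · field_simp
      linear_combination b * α * h2
    · have : α / γ * δ = α * h ^ 2 := by rw [hh]; field_simp
      rw [this, ← hbd]
      ring
    · field_simp
    · field_simp
      linear_combination (-1) * hh'

end ConicNormalForms

/-! ### Two invariants separating planes of equal distribution. -/

section Invariants

variable {F : Type*} [Field F]

/-- Some nonzero vector is isotropic for all matrices of `W` and lies in the kernel of all matrices
of `W` with zero diagonal. -/
def HasIsotropicNucleus (W : Submodule F (Fin 6 → F)) : Prop :=
  ∃ k : Fin 3 → F, k ≠ 0 ∧ (∀ y ∈ W, k ⬝ᵥ (symMatrix y).mulVec k = 0) ∧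
    ∀ y ∈ W ⊓ zeroDiag F, (symMatrix y).mulVec k = 0

/-- Some nonzero vector is sent into a fixed line by all matrices of `W`. -/
def HasCollinearImages (W : Submodule F (Fin 6 → F)) : Prop :=
  ∃ k : Fin 3 → F, k ≠ 0 ∧ ∃ w : Fin 3 → F, ∀ y ∈ W, ∃ c : F, (symMatrix y).mulVec k = c • w

theorem transpose_mulVec_inv (A : GL (Fin 3) F) (k : Fin 3 → F) :
    A.1.transpose.mulVec ((A⁻¹ : GL (Fin 3) F).1.transpose.mulVec k) = k := by
  rw [Matrix.mulVec_mulVec, ← Matrix.transpose_mul, ← Units.val_mul, inv_mul_cancel,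
    Units.val_one, Matrix.transpose_one, Matrix.one_mulVec]

/-- Since (AMAᵀ)(A⁻ᵀk) = A(Mk), both invariants are transported by k ↦ A⁻ᵀk. -/
theorem symMatrix_symLift_mulVec (A : GL (Fin 3) F) (y : Fin 6 → F) (k : Fin 3 → F) :
    (symMatrix (symLift A.1 y)).mulVec ((A⁻¹ : GL (Fin 3) F).1.transpose.mulVec k) =
      A.1.mulVec ((symMatrix y).mulVec k) := by
  rw [symMatrix_symLift, ← Matrix.mulVec_mulVec, transpose_mulVec_inv, Matrix.mulVec_mulVec]

theorem inv_transpose_mulVec_ne_zero (A : GL (Fin 3) F) {k : Fin 3 → F} (hk : k ≠ 0) :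
    (A⁻¹ : GL (Fin 3) F).1.transpose.mulVec k ≠ 0 := by
  intro h
  apply hk
  rw [← transpose_mulVec_inv A k, h, Matrix.mulVec_zero]

theorem HasIsotropicNucleus.congr [CharP F 2] {W W' : Submodule F (Fin 6 → F)}
    (h : HasIsotropicNucleus W) (hc : IsCongruent W W') : HasIsotropicNucleus W' := by
  obtain ⟨k, hk, h1, h2⟩ := h
  obtain ⟨A, rfl⟩ := hc
  refine ⟨_, inv_transpose_mulVec_ne_zero A hk, ?_, ?_⟩
  · rintro _ ⟨y, hy, rfl⟩
    rw [symMatrix_symLift_mulVec, Matrix.dotProduct_mulVec, ← Matrix.mulVec_transpose,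
      transpose_mulVec_inv, h1 y hy]
  · rw [map_symLift_inf_zeroDiag]
    rintro _ ⟨y, hy, rfl⟩
    rw [symMatrix_symLift_mulVec, h2 y hy, Matrix.mulVec_zero]

theorem HasCollinearImages.congr {W W' : Submodule F (Fin 6 → F)}
    (h : HasCollinearImages W) (hc : IsCongruent W W') : HasCollinearImages W' := by
  obtain ⟨k, hk, w, h1⟩ := h
  obtain ⟨A, rfl⟩ := hc
  refine ⟨_, inv_transpose_mulVec_ne_zero A hk, A.1.mulVec w, ?_⟩
  rintro _ ⟨y, hy, rfl⟩
  obtain ⟨c, hcw⟩ := h1 y hy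
  exact ⟨c, by rw [symMatrix_symLift_mulVec, hcw, Matrix.mulVec_smul]⟩

theorem symMatrix_mulVec (y : Fin 6 → F) (k : Fin 3 → F) : (symMatrix y).mulVec k =
    ![y 0 * k 0 + y 1 * k 1 + y 2 * k 2, y 1 * k 0 + y 3 * k 1 + y 4 * k 2,
      y 2 * k 0 + y 4 * k 1 + y 5 * k 2] := by
  ext i
  fin_cases i <;> simp [symMatrix, Matrix.mulVec, dotProduct, Fin.sum_univ_three]

theorem hasIsotropicNucleus_cubicFamily (α β γ δ : F) :
    HasIsotropicNucleus (cubicFamily α β γ δ) := by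
  refine ⟨![0, 0, 1], fun h => one_ne_zero (congrFun h 2), ?_, ?_⟩
  · intro y hy
    obtain ⟨h5, -, -⟩ := mem_cubicFamily.1 hy
    rw [symMatrix_mulVec]
    simp [h5]
  · rintro y ⟨hy, h0, h3, h5⟩
    obtain ⟨-, h2, h4⟩ := mem_cubicFamily.1 hy
    rw [symMatrix_mulVec]
    simp [h5, h2, h4, h0, h3]

/-- The kernel of the nucleus matrix is spanned by e₁, but the family contains a matrix with y₃ = 1.
-/
theorem not_hasIsotropicNucleus_conicFamily (α β γ δ : F) :
    ¬ HasIsotropicNucleus (conicFamily α β γ δ) := by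
  rintro ⟨k, hk, h1, h2⟩
  have hN := h2 ![0, 0, 1, 0, 0, 0] ⟨by simp [mem_conicFamily], by simp [mem_zeroDiag]⟩
  rw [symMatrix_mulVec] at hN
  have k2 : k 2 = 0 := by simpa using congrFun hN 0
  have k0 : k 0 = 0 := by simpa using congrFun hN 2
  have hY := h1 ![0, β, 0, 1, δ, 0] (by simp [mem_conicFamily])
  rw [symMatrix_mulVec] at hY
  have k1 : k 1 = 0 := by simpa [dotProduct, Fin.sum_univ_three, k0, k2] using hY
  apply hk
  ext i
  fin_cases i <;> simp [k0, k1, k2]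

theorem hasCollinearImages_conicFamily (α β : F) :
    HasCollinearImages (conicFamily α β 0 0) := by
  refine ⟨![0, 0, 1], fun h => one_ne_zero (congrFun h 2), ![1, 0, 0], ?_⟩
  intro y hy
  obtain ⟨h5, -, h4⟩ := mem_conicFamily.1 hy
  refine ⟨y 2, ?_⟩
  rw [symMatrix_mulVec]
  simp [h5, h4]

/-- The images of k under three spanning matrices are (k₂, 0, k₀), (k₀ + k₁, k₀, 0) and (0, k₁ + k₂,
k₁). If all are multiples of w, their 2×2 minors vanish, which forces k = 0. -/
theorem not_hasCollinearImages_conicFamily :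
    ¬ HasCollinearImages (conicFamily (1 : F) 0 0 1) := by
  rintro ⟨k, hk, w, h⟩
  obtain ⟨a, ha⟩ := h ![0, 0, 1, 0, 0, 0] (by simp [mem_conicFamily])
  obtain ⟨b, hb⟩ := h ![1, 1, 0, 0, 0, 0] (by simp [mem_conicFamily])
  obtain ⟨c, hc⟩ := h ![0, 0, 0, 1, 1, 0] (by simp [mem_conicFamily])
  rw [symMatrix_mulVec] at ha hb hc
  have ha0 : k 2 = a * w 0 := by simpa using congrFun ha 0
  have ha1 : 0 = a * w 1 := by simpa using congrFun ha 1
  have ha2 : k 0 = a * w 2 := by simpa using congrFun ha 2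
  have hb0 : k 0 + k 1 = b * w 0 := by simpa using congrFun hb 0
  have hb1 : k 0 = b * w 1 := by simpa using congrFun hb 1
  have hc0 : 0 = c * w 0 := by simpa using congrFun hc 0
  have hc1 : k 1 + k 2 = c * w 1 := by simpa using congrFun hc 1
  have k0 : k 0 = 0 := by
    have : k 0 * k 0 = 0 := by linear_combination k 0 * ha2 + a * w 2 * hb1 - b * w 2 * ha1
    simpa using this
  have hk12 : k 1 * (k 1 + k 2) = 0 := by
    linear_combination (k 1 + k 2) * (hb0 - k0) + b * w 0 * hc1 - b * w 1 * hc0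
  have hk22 : k 2 * (k 1 + k 2) = 0 := by
    linear_combination (k 1 + k 2) * ha0 + a * w 0 * hc1 - c * w 0 * ha1
  have hc2 : k 1 = c * w 2 := by simpa using congrFun hc 2
  have hk21 : k 2 * k 1 = 0 := by
    linear_combination k 1 * ha0 + a * w 0 * hc2 - a * w 2 * hc0
  have k2 : k 2 = 0 := by
    have : k 2 * k 2 = 0 := by linear_combination hk22 - hk21
    simpa using this
  have k1 : k 1 = 0 := by
    have : k 1 * k 1 = 0 := by linear_combination hk12 - hk21
    simpa using this
  apply hk
  ext i
  fin_cases i <;> simp [k0, k1, k2]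

end Invariants

/-! ### Representatives and orbit counts. -/

section Main

variable {F : Type*} [Field F]

theorem isPlane_nucleusPlane : IsPlane (nucleusPlane F) :=
  isPlane_iff.2 ⟨_, finrank_zeroDiag, nucleusPlane_eq⟩

theorem nucleusPlane_inter_surface : nucleusPlane F ∩ surface F = ∅ := by
  rw [nucleusPlane_eq, points_inter_surface_eq_empty_iff]
  rintro u hu ⟨h0, h3, h5⟩
  simp only [veroneseVec, Matrix.cons_val] at h0 h3 h5
  simp at h0 h3 h5
  apply hu
  ext i
  fin_cases i <;> simp [*]

theorem disjointPlaneOrbits_and_true (c : Set (PG5 F) → Prop) :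
    disjointPlaneOrbits c = disjointPlaneOrbits fun π => c π ∧ True := by
  simp

theorem meetsNucleusInPoint_iff [Finite F] {W : Submodule F (Fin 6 → F)} :
    MeetsNucleusInPoint (points W) ↔ Module.finrank F ↥(W ⊓ zeroDiag F) = 1 := by
  rw [MeetsNucleusInPoint, nucleusPlane_eq, ← points_inf, ← ncard_points_eq_one_iff,
    Set.ncard_eq_one]

/-- All lines of the nucleus plane lie in the one orbit o₁₂,₁, so membership in it reduces to a
dimension. -/
theorem meetsNucleusInLine_iff [CharP F 2] {W : Submodule F (Fin 6 → F)} :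
    MeetsNucleusInLine (points W) ↔ Module.finrank F ↥(W ⊓ zeroDiag F) = 2 := by
  rw [MeetsNucleusInLine, nucleusPlane_eq, ← points_inf, o12_1, line12_1_eq,
    points_mem_orbit_iff]
  constructor
  · intro h
    rw [← h.finrank_eq, finrank_baseLine]
  · exact isCongruent_baseLine inf_le_right

theorem OD0_eq_iff_of_isCongruent [CharP F 2] (v : Fin 4 → ℕ) (U U' : Submodule F (Fin 6 → F))
    (h : IsCongruent U U') : OD0 (points U) = v ↔ OD0 (points U') = v := by
  rw [h.OD0_eq]

variable [Finite F] [CharP F 2]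

theorem OD0_nucleusPlane :
    OD0 (nucleusPlane F) = ![0, Nat.card F ^ 2 + Nat.card F + 1, 0, 0] := by
  have hs := nucleusPlane_inter_surface (F := F)
  rw [nucleusPlane_eq] at hs ⊢
  have h := OD0_points finrank_zeroDiag hs (a := Nat.card F ^ 2 + Nat.card F + 1) (b := 0)
    (by rw [inf_idem]; exact ncard_points_of_finrank_eq_three finrank_zeroDiag) ?_
  · simpa using h
  · rw [zero_mul, Set.ncard_eq_zero (Set.toFinite _), Set.eq_empty_iff_forall_notMem]
    rintro y ⟨h, h', -⟩
    exact h' h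

/-- Representatives of the planes meeting the nucleus plane in a line. -/
def lineForms (F : Type*) [Field F] : Fin 2 → Submodule F (Fin 6 → F) :=
  ![lineFamily 0 1 0 1, lineFamily 1 0 0 1]

theorem OD0_lineForms (i : Fin 2) : OD0 (points (lineForms F i)) =
    ![0, Nat.card F + 1, ![0, Nat.card F] i, Nat.card F ^ 2 - ![0, Nat.card F] i] := by
  fin_cases i
  · simpa [lineForms] using OD0_lineFamily_zero (F := F)
  · simpa [lineForms] using OD0_lineFamily_one (F := F)

theorem exists_isCongruent_lineForms {W : Submodule F (Fin 6 → F)}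
    (hW : Module.finrank F W = 3) (hs : points W ∩ surface F = ∅)
    (hZ : Module.finrank F ↥(W ⊓ zeroDiag F) = 2) : ∃ i, IsCongruent (lineForms F i) W := by
  rcases line_classification hW hs hZ with h | h
  · exact ⟨0, h⟩
  · exact ⟨1, h⟩

theorem ncard_lineOrbits (d : Set (PG5 F) → Prop)
    (hd : ∀ U U', IsCongruent U U' → (d (points U) ↔ d (points U'))) :
    (disjointPlaneOrbits fun π => MeetsNucleusInLine π ∧ d π).ncard =
      {i | d (points (lineForms F i))}.ncard := by
  refine ncard_disjointPlaneOrbits (lineForms F) d hd ?_ ?_ ?_ ?_ ?_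
  · intro i
    fin_cases i
    · exact finrank_lineFamily (by simp)
    · exact finrank_lineFamily (by simp)
  · intro i
    fin_cases i
    · exact lineFamily_inter_surface (by simp)
    · exact lineFamily_inter_surface (by simp)
  · intro i
    rw [meetsNucleusInLine_iff, ← finrank_baseLine (F := F)]
    fin_cases i
    · exact congrArg (fun U : Submodule F (Fin 6 → F) => Module.finrank F U)
        (lineFamily_inf_zeroDiag (by simp))
    · exact congrArg (fun U : Submodule F (Fin 6 → F) => Module.finrank F U)
        (lineFamily_inf_zeroDiag (by simp))
  · exact fun U hU hs hc => exists_isCongruent_lineForms hU hs (meetsNucleusInLine_iff.1 hc)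
  · intro i j h
    have h' := congrFun h.OD0_eq 2
    rw [OD0_lineForms, OD0_lineForms] at h'
    have hq : Nat.card F ≠ 0 := Nat.card_pos.ne'
    fin_cases i <;> fin_cases j <;> simp [hq, hq.symm] at h' ⊢

/-- Representatives of the planes meeting the nucleus plane in a point. -/
def pointForms (e α β γ δ : F) : Fin 6 → Submodule F (Fin 6 → F) :=
  ![cubicFamily α β γ δ, cubicFamily 1 0 0 1, cubicFamily 1 0 e 1, conicFamily 0 1 1 0,
    conicFamily 1 0 0 1, conicFamily 1 e 0 0]

/-- The numbers of points of rank two outside the nucleus plane in the `pointForms`. -/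
def pointFormsCount (q : ℕ) : Fin 6 → ℕ := ![0, 3 * q, q, q, 2 * q, 2 * q]

variable {e α β γ δ : F}

theorem OD0_pointForms (he : ∀ t, t ^ 2 + t ≠ e) (hf : CubicAnisotropic α β γ δ) (i : Fin 6) :
    OD0 (points (pointForms e α β γ δ i)) = ![0, 1, pointFormsCount (Nat.card F) i,
      Nat.card F ^ 2 + Nat.card F - pointFormsCount (Nat.card F) i] := by
  fin_cases i
  · exact OD0_cubicFamily_of_no_root hf.det_ne_zero hf
  · exact OD0_cubicFamily_three_roots
  · simpa [pointForms, pointFormsCount] using OD0_cubicFamily_one_root he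
  · simpa [pointForms, pointFormsCount] using OD0_conicFamily_one (F := F)
  · exact OD0_conicFamily_two'
  · exact OD0_conicFamily_two he

theorem pointForms_inter_surface (he : ∀ t, t ^ 2 + t ≠ e) (hf : CubicAnisotropic α β γ δ)
    (i : Fin 6) : points (pointForms e α β γ δ i) ∩ surface F = ∅ := by
  fin_cases i
  · exact cubicFamily_inter_surface hf.det_ne_zero
  · exact cubicFamily_inter_surface (by simp)
  · exact cubicFamily_inter_surface (by simp)
  · refine conicFamily_inter_surface fun x y h h' => ?_
    have hx : x = 0 := by simpa using h'
    subst hx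
    exact ⟨rfl, by simpa using h.symm⟩
  · refine conicFamily_inter_surface fun x y h h' => ?_
    have hy : y = 0 := by simpa using h'
    subst hy
    exact ⟨by simpa using h.symm, rfl⟩
  · exact conicFamily_inter_surface fun x y h _ => eq_zero_of_artinSchreier he h

theorem exists_isCongruent_pointForms (he : ∀ t, t ^ 2 + t ≠ e) (hf : CubicAnisotropic α β γ δ)
    {W : Submodule F (Fin 6 → F)} (hW : Module.finrank F W = 3)
    (hs : points W ∩ surface F = ∅) (hZ : Module.finrank F ↥(W ⊓ zeroDiag F) = 1) :
    ∃ i, IsCongruent (pointForms e α β γ δ i) W := by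
  obtain ⟨a, b, c, d, h | h⟩ := isCongruent_family hW hZ
  · rcases cubicFamily_classification he hf (h.inter_surface hs) with h' | h' | h'
    · exact ⟨0, h'.trans h.symm⟩
    · exact ⟨2, h'.trans h.symm⟩
    · exact ⟨1, h'.trans h.symm⟩
  · rcases conicFamily_classification he (h.inter_surface hs) with h' | h' | h'
    · exact ⟨3, h'.trans h.symm⟩
    · exact ⟨4, h'.trans h.symm⟩
    · exact ⟨5, h'.trans h.symm⟩

theorem ncard_pointOrbits (he : ∀ t, t ^ 2 + t ≠ e) (hf : CubicAnisotropic α β γ δ)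
    (d : Set (PG5 F) → Prop)
    (hd : ∀ U U', IsCongruent U U' → (d (points U) ↔ d (points U'))) :
    (disjointPlaneOrbits fun π => MeetsNucleusInPoint π ∧ d π).ncard =
      {i | d (points (pointForms e α β γ δ i))}.ncard := by
  refine ncard_disjointPlaneOrbits (pointForms e α β γ δ) d hd ?_
    (pointForms_inter_surface he hf) ?_ ?_ ?_
  · intro i
    fin_cases i
    · exact finrank_cubicFamily _ _ _ _
    · exact finrank_cubicFamily _ _ _ _
    · exact finrank_cubicFamily _ _ _ _
    · exact finrank_conicFamily _ _ _ _
    · exact finrank_conicFamily _ _ _ _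
    · exact finrank_conicFamily _ _ _ _
  · intro i
    rw [meetsNucleusInPoint_iff]
    fin_cases i
    · exact finrank_cubicFamily_inf_zeroDiag _ _ _ _
    · exact finrank_cubicFamily_inf_zeroDiag _ _ _ _
    · exact finrank_cubicFamily_inf_zeroDiag _ _ _ _
    · exact finrank_conicFamily_inf_zeroDiag _ _ _ _
    · exact finrank_conicFamily_inf_zeroDiag _ _ _ _
    · exact finrank_conicFamily_inf_zeroDiag _ _ _ _
  · exact fun U hU hs hc =>
      exists_isCongruent_pointForms he hf hU hs (meetsNucleusInPoint_iff.1 hc)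
  · intro i j h
    have h' := congrFun h.OD0_eq 2
    rw [OD0_pointForms he hf, OD0_pointForms he hf] at h'
    change pointFormsCount _ i = pointFormsCount _ j at h'
    have hq : 0 < Nat.card F := Nat.card_pos
    -- Comparing the numbers of rank-two points outside the nucleus plane leaves only two pairs to
    -- the finer invariants.
    have key : (i = 2 ∧ j = 3) ∨ (i = 3 ∧ j = 2) ∨ (i = 4 ∧ j = 5) ∨ (i = 5 ∧ j = 4) ∨
        i = j := by
      fin_cases i <;> fin_cases j <;> simp [pointFormsCount] at h' ⊢ <;> omega
    rcases key with ⟨rfl, rfl⟩ | ⟨rfl, rfl⟩ | ⟨rfl, rfl⟩ | ⟨rfl, rfl⟩ | h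
    · exact absurd ((hasIsotropicNucleus_cubicFamily _ _ _ _).congr h)
        (not_hasIsotropicNucleus_conicFamily _ _ _ _)
    · exact absurd ((hasIsotropicNucleus_cubicFamily _ _ _ _).congr h.symm)
        (not_hasIsotropicNucleus_conicFamily _ _ _ _)
    · exact absurd ((hasCollinearImages_conicFamily _ _).congr h.symm)
        not_hasCollinearImages_conicFamily
    · exact absurd ((hasCollinearImages_conicFamily _ _).congr h)
        not_hasCollinearImages_conicFamily
    · exact h

end Main

/-! ### Orbits with a prescribed distribution. -/

section Totals

variable {F : Type*} [Field F] [Finite F] [CharP F 2] {e α β γ δ : F}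

theorem ncard_lineOrbits_OD0 (n : ℕ) :
    (disjointPlaneOrbits (F := F) fun π => MeetsNucleusInLine π ∧
      OD0 π = ![0, Nat.card F + 1, n, Nat.card F ^ 2 - n]).ncard =
      {i : Fin 2 | ![0, Nat.card F] i = n}.ncard := by
  rw [ncard_lineOrbits _ (OD0_eq_iff_of_isCongruent _)]
  congr 1
  ext i
  rw [Set.mem_ofPred_eq, Set.mem_ofPred_eq, OD0_lineForms]
  exact ⟨fun h => congrFun h 2, fun h => by rw [h]⟩

theorem ncard_pointOrbits_OD0 (he : ∀ t, t ^ 2 + t ≠ e) (hf : CubicAnisotropic α β γ δ) (n : ℕ) :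
    (disjointPlaneOrbits (F := F) fun π => MeetsNucleusInPoint π ∧
      OD0 π = ![0, 1, n, Nat.card F ^ 2 + Nat.card F - n]).ncard =
      {i | pointFormsCount (Nat.card F) i = n}.ncard := by
  rw [ncard_pointOrbits he hf _ (OD0_eq_iff_of_isCongruent _)]
  congr 1
  ext i
  rw [Set.mem_ofPred_eq, Set.mem_ofPred_eq, OD0_pointForms he hf]
  exact ⟨fun h => congrFun h 2, fun h => by rw [h]⟩

theorem setOf_pointFormsCount_eq {q : ℕ} (hq : 0 < q) :
    {i | pointFormsCount q i = 0} = {0} ∧ {i | pointFormsCount q i = 3 * q} = {1} ∧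
      {i | pointFormsCount q i = q} = {2, 3} ∧ {i | pointFormsCount q i = 2 * q} = {4, 5} := by
  refine ⟨?_, ?_, ?_, ?_⟩ <;> ext i <;> fin_cases i <;> simp [pointFormsCount] <;> omega

theorem setOf_lineFormsCount_eq {q : ℕ} (hq : 0 < q) :
    {i : Fin 2 | ![0, q] i = 0} = {0} ∧ {i : Fin 2 | ![0, q] i = q} = {1} := by
  constructor <;> ext i <;> fin_cases i <;> simp <;> omega

end Totals

end VeroneseSurface

open VeroneseSurface in
theorem mainTheorem2 (F : Type*) [Field F] [Finite F] [CharP F 2] (q : ℕ) (hq : Nat.card F = q) :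
    -- the trichotomy, with the possible point-orbit distributions
    (∀ π : Set (PG5 F), IsPlane π → π ∩ surface F = ∅ → (π ∩ nucleusPlane F).Nonempty →
      π = nucleusPlane F ∨
      (MeetsNucleusInLine π ∧ (r2s π = 0 ∨ r2s π = q) ∧
        (OD0 π = ![0, q + 1, 0, q ^ 2] ∨ OD0 π = ![0, q + 1, q, q ^ 2 - q])) ∨
      (MeetsNucleusInPoint π ∧ (r2s π = 0 ∨ r2s π = q ∨ r2s π = 2 * q ∨ r2s π = 3 * q) ∧
        (OD0 π = ![0, 1, 0, q ^ 2 + q] ∨ OD0 π = ![0, 1, 3 * q, q ^ 2 - 2 * q] ∨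
          OD0 π = ![0, 1, q, q ^ 2] ∨ OD0 π = ![0, 1, 2 * q, q ^ 2 - q]))) ∧
    -- the nucleus plane itself
    (IsPlane (nucleusPlane F) ∧ OD0 (nucleusPlane F) = ![0, q ^ 2 + q + 1, 0, 0] ∧
      nucleusPlane F ∩ surface F = ∅) ∧
    -- planes meeting the nucleus plane in a line
    ((disjointPlaneOrbits (F := F) MeetsNucleusInLine).ncard = 2 ∧
      (disjointPlaneOrbits (F := F) fun π =>
        MeetsNucleusInLine π ∧ OD0 π = ![0, q + 1, 0, q ^ 2]).ncard = 1 ∧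
      (disjointPlaneOrbits (F := F) fun π =>
        MeetsNucleusInLine π ∧ OD0 π = ![0, q + 1, q, q ^ 2 - q]).ncard = 1) ∧
    -- planes meeting the nucleus plane in a point
    ((disjointPlaneOrbits (F := F) MeetsNucleusInPoint).ncard = 6 ∧
      (disjointPlaneOrbits (F := F) fun π =>
        MeetsNucleusInPoint π ∧ OD0 π = ![0, 1, 0, q ^ 2 + q]).ncard = 1 ∧
      (disjointPlaneOrbits (F := F) fun π =>
        MeetsNucleusInPoint π ∧ OD0 π = ![0, 1, 3 * q, q ^ 2 - 2 * q]).ncard = 1 ∧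
      (disjointPlaneOrbits (F := F) fun π =>
        MeetsNucleusInPoint π ∧ OD0 π = ![0, 1, q, q ^ 2]).ncard = 2 ∧
      (disjointPlaneOrbits (F := F) fun π =>
        MeetsNucleusInPoint π ∧ OD0 π = ![0, 1, 2 * q, q ^ 2 - q]).ncard = 2) := by
  subst hq
  have hq : 0 < Nat.card F := Nat.card_pos
  obtain ⟨e, he⟩ := exists_forall_sq_add_self_ne (F := F)
  obtain ⟨α, β, γ, δ, hf⟩ := exists_cubicAnisotropic (F := F)
  obtain ⟨p0, p3, p1, p2⟩ := setOf_pointFormsCount_eq hq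
  obtain ⟨l0, l1⟩ := setOf_lineFormsCount_eq hq
  -- The orbit counts are stated for last entries q² - n and q² + q - n; these identities bring the
  -- stated distributions to that shape.
  have q0 : Nat.card F ^ 2 = Nat.card F ^ 2 - 0 := rfl
  have q1 : Nat.card F ^ 2 + Nat.card F = Nat.card F ^ 2 + Nat.card F - 0 := rfl
  have q2 : Nat.card F ^ 2 - 2 * Nat.card F = Nat.card F ^ 2 + Nat.card F - 3 * Nat.card F := by
    omega
  have q3 : Nat.card F ^ 2 = Nat.card F ^ 2 + Nat.card F - Nat.card F := by omega
  have q4 : Nat.card F ^ 2 - Nat.card F = Nat.card F ^ 2 + Nat.card F - 2 * Nat.card F := by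
    omega
  refine ⟨?_, ⟨isPlane_nucleusPlane, OD0_nucleusPlane, nucleusPlane_inter_surface⟩,
    ⟨?_, ?_, ?_⟩, ⟨?_, ?_, ?_, ?_, ?_⟩⟩
  · rintro π hπ hs ⟨P, hP, hPN⟩
    obtain ⟨W, hW, rfl⟩ := isPlane_iff.1 hπ
    have hle : Module.finrank F ↥(W ⊓ zeroDiag F) ≤ 3 :=
      hW ▸ Submodule.finrank_mono inf_le_left
    have hpos : Module.finrank F ↥(W ⊓ zeroDiag F) ≠ 0 := by
      intro h0
      have hbot : W ⊓ zeroDiag F = ⊥ := Submodule.finrank_eq_zero.1 h0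
      have hmem : P.rep ∈ W ⊓ zeroDiag F := ⟨mem_points.1 hP, hPN⟩
      rw [hbot, Submodule.mem_bot] at hmem
      exact P.rep_nonzero hmem
    have hcases : Module.finrank F ↥(W ⊓ zeroDiag F) = 3 ∨
        Module.finrank F ↥(W ⊓ zeroDiag F) = 2 ∨ Module.finrank F ↥(W ⊓ zeroDiag F) = 1 := by
      omega
    rcases hcases with h | h | h
    · left
      have e1 : W ⊓ zeroDiag F = W :=
        Submodule.eq_of_le_of_finrank_eq inf_le_left (h.trans hW.symm)
      have e2 : W ⊓ zeroDiag F = zeroDiag F :=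
        Submodule.eq_of_le_of_finrank_eq inf_le_right (h.trans finrank_zeroDiag.symm)
      rw [nucleusPlane_eq, ← e2, e1]
    · right; left
      refine ⟨meetsNucleusInLine_iff.2 h, ?_⟩
      obtain ⟨i, hi⟩ := exists_isCongruent_lineForms hW hs h
      have hOD := hi.OD0_eq.symm.trans (OD0_lineForms i)
      have hr : r2s (points W) = ![0, Nat.card F] i := congrFun hOD 2
      rw [hr, hOD]
      fin_cases i <;> simp
    · right; right
      refine ⟨meetsNucleusInPoint_iff.2 h, ?_⟩
      obtain ⟨i, hi⟩ := exists_isCongruent_pointForms he hf hW hs h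
      have hOD := hi.OD0_eq.symm.trans (OD0_pointForms he hf i)
      have hr : r2s (points W) = pointFormsCount (Nat.card F) i := congrFun hOD 2
      rw [hr, hOD, q2, q4]
      fin_cases i <;> simp [pointFormsCount]
  · rw [disjointPlaneOrbits_and_true, ncard_lineOrbits (fun _ => True) fun _ _ _ => Iff.rfl]
    simp
  · rw [q0, ncard_lineOrbits_OD0, l0, Set.ncard_singleton]
  · rw [ncard_lineOrbits_OD0, l1, Set.ncard_singleton]
  · rw [disjointPlaneOrbits_and_true,
      ncard_pointOrbits he hf (fun _ => True) fun _ _ _ => Iff.rfl]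
    simp
  · rw [q1, ncard_pointOrbits_OD0 he hf, p0, Set.ncard_singleton]
  · rw [q2, ncard_pointOrbits_OD0 he hf, p3, Set.ncard_singleton]
  · rw [q3, ncard_pointOrbits_OD0 he hf, p1, Set.ncard_pair (by decide)]
  · rw [q4, ncard_pointOrbits_OD0 he hf, p2, Set.ncard_pair (by decide)]
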